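/- Let $A$ be a unital $C^*$-algebra and let $M$ be an essential correspondence over $A$: a right Hilbert $A$-module (with $A$-valued inner product linear in the second variable) with a left action of $A$ given by a $*$-homomorphism of $A$ into the adjointable operators on $M$, such that $1\cdot n=n$ for all $n\in M$. A countable family $(x_j)_{j\in J}$ in a Hilbert $A$-module $X$ is a Parseval frame for $X$ if $\langle x,x\rangle=\sum_{j\in J}\langle x,x_j\rangle\langle x_j,x\rangle$ for every $x\in X$, where the finite partial sums converge in norm along the finite subsets of $J$. It is an orthonormal basis for $X$ if $\langle x_i,x_j\rangle=\delta_{i,j}1$ for all $i,j$ and the $A$-linear combinations of the $x_j$ are dense in $X$. Let $(m_j)_{j\in J}$ be a Parseval frame for $M$, indexed by a countable set $J$ with a distinguished element $0\in J$, such that $\langle m_0,m_0\rangle=1$. Let $M^{\otimes 0}=A$, and let $M^{\otimes k}=M\otimes_A\cdots\otimes_A M$ ($k$ factors) be the internal tensor power, that is, the completion of the algebraic tensor product for $\langle m\otimes x,n\otimes y\rangle=\langle\langle n,m\rangle\cdot x,y\rangle$. Define inner-product preserving maps $T_k:M^{\otimes k}\to M^{\otimes(k+1)}$ by $T_kn=m_0\otimes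 n$ (for $k=0$, $T_0a=m_0\cdot a$ under the identification $M\otimes_A A\cong M$). Let $(M_\infty,\iota^k)=\varinjlim(M^{\otimes k},T_k)$ be the Hilbert module direct limit: the completion of the quotient of the disjoint union of the $M^{\otimes k}$ in which each $n\in M^{\otimes k}$ is identified with $T_kn$, with $\iota^k(n)$ the class of $n$. Then the family $$\{\iota^0(1)\}\cup\{\iota^k(m_{j_1}\otimes\cdots\otimes m_{j_k}) : k\ge 1,\ j_1,\dots,j_k\in J,\ j_1\neq 0\},$$ indexed by one point together with the tuples $(j_1,\dots,j_k)$ with $k\geq1$ and $j_1\ne 0$, is a Parseval frame for $M_\infty$. If moreover $(m_j)_{j\in J}$ is an orthonormal basis for $M$, then this family is an orthonormal basis for $M_\infty$. -/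

import Mathlib

open MulOpposite UniformSpace UniformSpace.Completion TensorProduct

universe u v w

/-- A complex vector space `E` with a right action of `A` (a module over `Aᵐᵒᵖ`, the element
`x · a` being `op a • x`) and an `A`-valued semi-inner product `⟨x, y⟩ = ip A x y`, linear in the
second variable. -/
class PreHilbertModule (A : Type u) (E : Type v) [CStarAlgebra A] [PartialOrder A]
    [AddCommGroup E] [Module ℂ E] [Module Aᵐᵒᵖ E] where
  /-- the `A`-valued (semi-)inner product -/
  ip (A) : E → E → A
  ip_add_right (x y z : E) : ip x (y + z) = ip x y + ip x z
  ip_smul_right (c : ℂ) (x y : E) : ip x (c • y) = c • ip x y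
  ip_op_smul_right (a : A) (x y : E) : ip x (op a • y) = ip x y * a
  star_ip (x y : E) : star (ip x y) = ip y x
  ip_self_nonneg (x : E) : 0 ≤ ip x x


/-- A (right) Hilbert `A`-module: the inner product is definite (as its norm
`‖x‖ = ‖⟨x, x⟩‖ ^ (1 / 2)` is a norm), and the module is complete. -/
class HilbertModule (A : Type u) (E : Type v) [CStarAlgebra A] [PartialOrder A]
    [NormedAddCommGroup E] [NormedSpace ℂ E] [Module Aᵐᵒᵖ E] extends
    PreHilbertModule A E, CompleteSpace E where
  norm_sq_eq (x : E) : ‖x‖ ^ 2 = ‖ip x x‖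

/-- A semi-inner product module with a left action of `A` by adjointable operators, the adjoint of
`x ↦ a • x` being `x ↦ star a • x`. -/
class PreCorrespondence (A : Type u) (E : Type v) [CStarAlgebra A] [PartialOrder A]
    [AddCommGroup E] [Module ℂ E] [Module Aᵐᵒᵖ E] [Module A E] extends
    PreHilbertModule A E where
  smul_assoc_left (c : ℂ) (a : A) (x : E) : (c • a) • x = c • (a • x)
  ip_smul_left (a : A) (x y : E) : ip (a • x) y = ip x (star a • y)

/-- An essential correspondence over the unital C⋆-algebra `A`: a Hilbert `A`-module together with
a ⋆-homomorphism from `A` to its adjointable operators, written as a left action `a • x`. That the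
correspondence is essential, `1 • x = x`, is part of the instance `Module A E`. -/
class EssentialCorrespondence (A : Type u) (E : Type v) [CStarAlgebra A] [PartialOrder A]
    [NormedAddCommGroup E] [NormedSpace ℂ E] [Module Aᵐᵒᵖ E] [Module A E] extends
    HilbertModule A E, PreCorrespondence A E

namespace PreHilbertModule

section Basic

variable (A : Type u) {E : Type v} [CStarAlgebra A] [PartialOrder A] [StarOrderedRing A]
  [AddCommGroup E] [Module ℂ E] [Module Aᵐᵒᵖ E] [PreHilbertModule A E]

theorem ip_add_left (x y z : E) : ip A (x + y) z = ip A x z + ip A y z := by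
  rw [← star_ip, ip_add_right, star_add, star_ip, star_ip]

theorem ip_smul_left' (c : ℂ) (x y : E) : ip A (c • x) y = star c • ip A x y := by
  rw [← star_ip, ip_smul_right, star_smul, star_ip]

theorem ip_op_smul_left (a : A) (x y : E) : ip A (op a • x) y = star a * ip A x y := by
  rw [← star_ip, ip_op_smul_right, star_mul, star_ip]

theorem ip_zero_right (x : E) : ip A x 0 = 0 := by
  have h := ip_smul_right (A := A) 0 x (0 : E)
  simpa using h

theorem ip_zero_left (x : E) : ip A 0 x = 0 := by
  rw [← star_ip, ip_zero_right, star_zero]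

theorem ip_neg_right (x y : E) : ip A x (-y) = -ip A x y := by
  have h := ip_smul_right (A := A) (-1) x y
  simpa using h

theorem ip_sub_right (x y z : E) : ip A x (y - z) = ip A x y - ip A x z := by
  rw [sub_eq_add_neg, ip_add_right, ip_neg_right, sub_eq_add_neg]

theorem ip_sub_left (x y z : E) : ip A (x - y) z = ip A x z - ip A y z := by
  rw [← star_ip, ip_sub_right, star_sub, star_ip, star_ip]

/-- The seminorm `‖⟨x, x⟩‖ ^ (1 / 2)`. -/
noncomputable def seminorm (x : E) : ℝ := √‖ip A x x‖

theorem seminorm_sq (x : E) : seminorm A x ^ 2 = ‖ip A x x‖ := Real.sq_sqrt (norm_nonneg _)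

theorem cauchySchwarz_aux (x y : E) (t : ℝ) (ht : 0 ≤ 2 * t - t ^ 2 * ‖ip A x x‖) :
    (2 * t - t ^ 2 * ‖ip A x x‖) * ‖ip A x y‖ ^ 2 ≤ ‖ip A y y‖ := by
  set s : A := ip A x y with hs
  have hs' : ip A y x = star s := (star_ip x y).symm
  have h0 := ip_self_nonneg (A := A) (y - op ((t : ℂ) • s) • x)
  rw [ip_sub_right, ip_sub_left, ip_sub_left, ip_op_smul_right, ip_op_smul_left,
    ip_op_smul_left, ip_op_smul_right, hs', ← hs] at h0
  have h1 : star s * ip A x x * s ≤ ‖ip A x x‖ • (star s * s) := by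
    have := CStarAlgebra.star_left_conjugate_le_norm_smul (a := s) (b := ip A x x)
      (hb := star_ip x x)
    simpa using this
  have h2 : (2 * t - t ^ 2 * ‖ip A x x‖) • (star s * s) ≤ ip A y y := by
    have h3 : t ^ 2 • (star s * ip A x x * s) ≤ t ^ 2 • (‖ip A x x‖ • (star s * s)) := by
      gcongr
    have h4 : 0 ≤ ip A y y - (2 * t) • (star s * s) + t ^ 2 • (star s * ip A x x * s) := by
      refine h0.trans_eq ?_
      simp only [Complex.coe_smul, star_smul, star_trivial, smul_mul_assoc, mul_smul_comm,
        smul_smul, mul_assoc, two_mul, add_smul, pow_two]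
      abel
    have h5 := h4.trans (add_le_add_right h3 _)
    rw [sub_smul, mul_smul (t ^ 2)]
    rw [← sub_nonneg]
    refine h5.trans_eq ?_
    abel
  have h6 := CStarAlgebra.norm_le_norm_of_nonneg_of_le
    (smul_nonneg ht (star_mul_self_nonneg s)) h2
  rwa [norm_smul, CStarRing.norm_star_mul_self, ← pow_two, Real.norm_of_nonneg ht] at h6

theorem norm_ip_sq_le (x y : E) : ‖ip A x y‖ ^ 2 ≤ ‖ip A x x‖ * ‖ip A y y‖ := by
  rcases (norm_nonneg (ip A x x)).eq_or_lt with h | h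
  · rw [← h, zero_mul]
    by_contra! hc
    have h1 := cauchySchwarz_aux A x y ((‖ip A y y‖ + 1) / (2 * ‖ip A x y‖ ^ 2)) (by
      rw [← h]; simp only [mul_zero, sub_zero]; positivity)
    rw [← h] at h1
    have : (2 * ((‖ip A y y‖ + 1) / (2 * ‖ip A x y‖ ^ 2)) -
      ((‖ip A y y‖ + 1) / (2 * ‖ip A x y‖ ^ 2)) ^ 2 * 0) * ‖ip A x y‖ ^ 2 = ‖ip A y y‖ + 1 := by
      rw [mul_zero, sub_zero, ← mul_div_assoc, mul_div_mul_left _ _ two_ne_zero,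
        div_mul_cancel₀ _ hc.ne']
    linarith
  · have h1 := cauchySchwarz_aux A x y (‖ip A x x‖⁻¹) (by
      have : 2 * ‖ip A x x‖⁻¹ - ‖ip A x x‖⁻¹ ^ 2 * ‖ip A x x‖ = ‖ip A x x‖⁻¹ := by
        field_simp; ring
      rw [this]; positivity)
    have : 2 * ‖ip A x x‖⁻¹ - ‖ip A x x‖⁻¹ ^ 2 * ‖ip A x x‖ = ‖ip A x x‖⁻¹ := by
      field_simp; ring
    rwa [this, inv_mul_le_iff₀ h] at h1

theorem norm_ip_le (x y : E) : ‖ip A x y‖ ≤ seminorm A x * seminorm A y := by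
  rw [seminorm, seminorm, ← Real.sqrt_mul (norm_nonneg _)]
  exact Real.le_sqrt_of_sq_le (norm_ip_sq_le A x y)

theorem seminorm_core : @SeminormedSpace.Core ℂ E _ _ ⟨seminorm A⟩ _ :=
  letI : Norm E := ⟨seminorm A⟩
  { norm_nonneg := fun x => Real.sqrt_nonneg _
    norm_smul := fun c x => by
      change √‖ip A (c • x) (c • x)‖ = ‖c‖ * √‖ip A x x‖
      rw [ip_smul_right, ip_smul_left', smul_smul, norm_smul, norm_mul, norm_star,
        Real.sqrt_mul (by positivity), Real.sqrt_mul_self (norm_nonneg _)]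
    norm_triangle := fun x y => by
      change seminorm A (x + y) ≤ seminorm A x + seminorm A y
      have hn : 0 ≤ seminorm A x + seminorm A y :=
        add_nonneg (Real.sqrt_nonneg _) (Real.sqrt_nonneg _)
      refine abs_le_of_sq_le_sq' ?_ hn |>.2
      rw [seminorm_sq, ip_add_right, ip_add_left, ip_add_left]
      change _ ≤ (seminorm A x + seminorm A y) ^ 2
      have h1 := norm_ip_le A x y
      have h2 := norm_ip_le A y x
      have h3 := seminorm_sq A x
      have h4 := seminorm_sq A y
      have h5 := norm_add₃_le (a := ip A x x) (b := ip A y x) (c := ip A x y + ip A y y)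
      have h6 := norm_add_le (ip A x y) (ip A y y)
      rw [← add_assoc] at h5 ⊢
      nlinarith }

end Basic

section Completion

variable (A : Type u) (E : Type v) [CStarAlgebra A] [PartialOrder A]
  [AddCommGroup E] [Module ℂ E] [Module Aᵐᵒᵖ E] [PreHilbertModule A E]

/-- The space `E` with the seminorm `‖⟨x, x⟩‖ ^ (1 / 2)`. -/
def Seminormed (_A : Type u) (E : Type v) : Type v := E

variable [StarOrderedRing A]

noncomputable instance : SeminormedAddCommGroup (Seminormed A E) :=
  letI : Norm E := ⟨seminorm A⟩
  (SeminormedAddCommGroup.ofCore (𝕜 := ℂ) (E := E) (seminorm_core A))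

noncomputable instance : NormedSpace ℂ (Seminormed A E) :=
  { (inferInstance : Module ℂ E) with
    norm_smul_le := fun c x =>
      (@SeminormedSpace.Core.norm_smul ℂ E _ _ ⟨seminorm A⟩ _ (seminorm_core A) c x).le }

noncomputable instance : Module Aᵐᵒᵖ (Seminormed A E) := (inferInstance : Module Aᵐᵒᵖ E)

noncomputable instance : PreHilbertModule A (Seminormed A E) :=
  { (inferInstance : PreHilbertModule A E) with }

variable {E}

theorem Seminormed.norm_sq_eq (x : Seminormed A E) : ‖x‖ ^ 2 = ‖ip A x x‖ :=
  seminorm_sq A (E := E) x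

theorem Seminormed.norm_ip_le (x y : Seminormed A E) : ‖ip A x y‖ ≤ ‖x‖ * ‖y‖ :=
  PreHilbertModule.norm_ip_le A (E := E) x y

variable (E)

theorem Seminormed.uniformContinuous_of_norm_le {R : Type w} [Ring R] [Module R (Seminormed A E)]
    (h : ∀ r : R, ∃ C : ℝ, ∀ x : Seminormed A E, ‖r • x‖ ≤ C * ‖x‖) :
    UniformContinuousConstSMul R (Seminormed A E) :=
  ⟨fun r => by
    obtain ⟨C, hC⟩ := h r
    exact uniformContinuous_of_continuousAt_zero
      (DistribSMul.toAddMonoidHom (Seminormed A E) r)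
      (AddMonoidHomClass.continuous_of_bound
        (DistribSMul.toAddMonoidHom (Seminormed A E) r) C hC).continuousAt⟩

noncomputable instance : UniformContinuousConstSMul Aᵐᵒᵖ (Seminormed A E) :=
  Seminormed.uniformContinuous_of_norm_le A E fun r => ⟨‖unop r‖, fun x => by
    refine abs_le_of_sq_le_sq' ?_ (by positivity) |>.2
    rw [mul_pow, Seminormed.norm_sq_eq A, Seminormed.norm_sq_eq A]
    obtain ⟨a, rfl⟩ := op_surjective r
    rw [ip_op_smul_right, ip_op_smul_left, unop_op]
    calc ‖star a * ip A x x * a‖ ≤ ‖star a‖ * ‖ip A x x‖ * ‖a‖ :=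
          (norm_mul_le _ _).trans (by gcongr; exact norm_mul_le _ _)
      _ = ‖a‖ ^ 2 * ‖ip A x x‖ := by rw [norm_star]; ring⟩

/-- The inner product as a biadditive map. -/
noncomputable def ipHom : Seminormed A E →+ Seminormed A E →+ A :=
  AddMonoidHom.mk' (fun x => AddMonoidHom.mk' (fun y => ip A x y) (ip_add_right x))
    fun x y => by ext z; exact ip_add_left A x y z

theorem continuous_ipHom :
    Continuous fun p : Seminormed A E × Seminormed A E => ipHom A E p.1 p.2 := by
  let f : Seminormed A E →ₗ⋆[ℂ] Seminormed A E →ₗ[ℂ] A :=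
    LinearMap.mk₂'ₛₗ (starRingEnd ℂ) (RingHom.id ℂ) (fun x y => ip A x y)
      (ip_add_left A) (ip_smul_left' A) ip_add_right ip_smul_right
  let hf := (f.mkContinuous₂ 1 fun x y => by
    rw [one_mul]
    exact Seminormed.norm_ip_le A x y)
  exact (hf.continuous.comp continuous_fst).clm_apply continuous_snd

/-- The completion of a semi-inner product module: vectors of length zero are divided out and the
quotient is completed in the norm `‖⟨x, x⟩‖ ^ (1 / 2)`. -/
def HilbertCompletion : Type v := Completion (Seminormed A E)

noncomputable instance : NormedAddCommGroup (HilbertCompletion A E) :=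
  inferInstanceAs (NormedAddCommGroup (Completion (Seminormed A E)))

noncomputable instance : NormedSpace ℂ (HilbertCompletion A E) :=
  inferInstanceAs (NormedSpace ℂ (Completion (Seminormed A E)))

noncomputable instance : Module Aᵐᵒᵖ (HilbertCompletion A E) :=
  inferInstanceAs (Module Aᵐᵒᵖ (Completion (Seminormed A E)))

instance : CompleteSpace (HilbertCompletion A E) :=
  inferInstanceAs (CompleteSpace (Completion (Seminormed A E)))

variable {E}

/-- The image of a vector in the completion. -/
noncomputable def toCompletion (x : E) : HilbertCompletion A E := Completion.coe' (α := Seminormed A E) x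

/-- The inner product of the completion, extended by continuity. -/
noncomputable def completionIp (x y : HilbertCompletion A E) : A :=
  ((isDenseInducing_toCompl (Seminormed A E)).prodMap
    (isDenseInducing_toCompl (Seminormed A E))).extend (fun p => ipHom A E p.1 p.2) (x, y)

theorem completionIp_coe (x y : E) :
    completionIp A (toCompletion A x) (toCompletion A y) = ip A x y :=
  ((isDenseInducing_toCompl (Seminormed A E)).prodMap
    (isDenseInducing_toCompl (Seminormed A E))).extend_eq (continuous_ipHom A E) (x, y)

variable (E) in
theorem continuous_completionIp :
    Continuous fun p : HilbertCompletion A E × HilbertCompletion A E =>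
      completionIp A p.1 p.2 :=
  (isDenseInducing_toCompl (Seminormed A E)).extend_Z_bilin
    (isDenseInducing_toCompl (Seminormed A E)) (continuous_ipHom A E)

theorem toCompletion_add (x y : E) :
    toCompletion A (x + y) = toCompletion A x + toCompletion A y :=
  Completion.coe_add (α := Seminormed A E) x y

theorem toCompletion_smul (c : ℂ) (x : E) : toCompletion A (c • x) = c • toCompletion A x :=
  Completion.coe_smul (X := Seminormed A E) c x

theorem toCompletion_op_smul (a : A) (x : E) :
    toCompletion A (op a • x) = op a • toCompletion A x :=
  Completion.coe_smul (X := Seminormed A E) (op a) x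

variable (E) in
theorem denseRange_toCompletion : DenseRange (toCompletion A (E := E)) :=
  Completion.denseRange_coe (α := Seminormed A E)

variable (E) in
instance : ContinuousConstSMul Aᵐᵒᵖ (HilbertCompletion A E) :=
  inferInstanceAs (ContinuousConstSMul Aᵐᵒᵖ (Completion (Seminormed A E)))

theorem continuous_completionIp_comp {α : Type w} [TopologicalSpace α] {f g : α → HilbertCompletion A E}
    (hf : Continuous f) (hg : Continuous g) :
    Continuous fun t => completionIp A (f t) (g t) :=
  (continuous_completionIp A E).comp (hf.prodMk hg)

theorem norm_toCompletion_sq (x : E) : ‖toCompletion A x‖ ^ 2 = ‖ip A x x‖ := by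
  have h := Completion.norm_coe (E := Seminormed A E) x
  exact (congrArg (· ^ 2) h).trans (Seminormed.norm_sq_eq A x)

variable (E)

noncomputable instance : HilbertModule A (HilbertCompletion A E) where
  ip := completionIp A
  ip_add_right x y z := by
    refine (denseRange_toCompletion A E).induction_on₃
      (p := fun x y z => completionIp A x (y + z) = completionIp A x y + completionIp A x z)
      (isClosed_eq
        (continuous_completionIp_comp A (continuous_fst) (continuous_snd.fst.add continuous_snd.snd))
        ((continuous_completionIp_comp A (continuous_fst) (continuous_snd.fst)).add (continuous_completionIp_comp A (continuous_fst) (continuous_snd.snd)))) (fun x y z => ?_) x y z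
    rw [← toCompletion_add, completionIp_coe, completionIp_coe, completionIp_coe, ip_add_right]
  ip_smul_right c x y := by
    refine (denseRange_toCompletion A E).induction_on₂
      (p := fun x y => completionIp A x (c • y) = c • completionIp A x y)
      (isClosed_eq (continuous_completionIp_comp A (continuous_fst) (continuous_snd.const_smul c))
        ((continuous_completionIp_comp A (continuous_fst) (continuous_snd)).const_smul c)) (fun x y => ?_) x y
    rw [← toCompletion_smul, completionIp_coe, completionIp_coe, ip_smul_right]
  ip_op_smul_right a x y := by
    refine (denseRange_toCompletion A E).induction_on₂
      (p := fun x y => completionIp A x (op a • y) = completionIp A x y * a)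
      (isClosed_eq (continuous_completionIp_comp A (continuous_fst) (continuous_snd.const_smul (op a)))
        ((continuous_completionIp_comp A (continuous_fst) (continuous_snd)).mul continuous_const)) (fun x y => ?_) x y
    rw [← toCompletion_op_smul, completionIp_coe, completionIp_coe, ip_op_smul_right]
  star_ip x y := by
    refine (denseRange_toCompletion A E).induction_on₂
      (p := fun x y => star (completionIp A x y) = completionIp A y x)
      (isClosed_eq (continuous_completionIp_comp A (continuous_fst) (continuous_snd)).star
        (continuous_completionIp_comp A (continuous_snd) (continuous_fst))) (fun x y => ?_) x y
    rw [completionIp_coe, completionIp_coe, star_ip]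
  ip_self_nonneg x := by
    refine (denseRange_toCompletion A E).induction_on
      (p := fun x => 0 ≤ completionIp A x x) x
      (CStarAlgebra.isClosed_nonneg.preimage
        (continuous_completionIp_comp A (continuous_id) (continuous_id))) (fun x => ?_)
    rw [completionIp_coe]
    exact ip_self_nonneg x
  norm_sq_eq x := by
    refine (denseRange_toCompletion A E).induction_on
      (p := fun x => ‖x‖ ^ 2 = ‖completionIp A x x‖) x
      (isClosed_eq (continuous_norm.pow 2)
        (continuous_completionIp_comp A (continuous_id) (continuous_id)).norm) (fun x => ?_)
    rw [completionIp_coe, norm_toCompletion_sq]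

theorem ip_toCompletion (x y : E) :
    ip A (toCompletion A x) (toCompletion A y) = ip A x y :=
  completionIp_coe A x y

end Completion

section LeftAction

variable (A : Type u) (E : Type v) [CStarAlgebra A] [PartialOrder A] [StarOrderedRing A]
  [AddCommGroup E] [Module ℂ E] [Module Aᵐᵒᵖ E] [Module A E] [PreCorrespondence A E]

noncomputable instance : Module A (Seminormed A E) := (inferInstance : Module A E)

variable {E} in
theorem norm_ip_left_smul_le (a : A) (x : E) :
    ‖ip A (a • x) (a • x)‖ ≤ ‖a‖ ^ 2 * ‖ip A x x‖ := by
  have h1 : 0 ≤ algebraMap ℝ A (‖a‖ ^ 2) - star a * a := by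
    rw [sub_nonneg, pow_two, ← CStarRing.norm_star_mul_self]
    exact (IsSelfAdjoint.star_mul_self a).le_algebraMap_norm_self
  obtain ⟨c, hc⟩ := CStarAlgebra.nonneg_iff_eq_star_mul_self.mp h1
  have h2 : ip A (a • x) (a • x) ≤ (‖a‖ ^ 2) • ip A x x := by
    have h3 : 0 ≤ ip A (c • x) (c • x) := ip_self_nonneg _
    rw [PreCorrespondence.ip_smul_left, smul_smul, ← hc, sub_smul, ip_sub_right,
      Algebra.algebraMap_eq_smul_one, ← Complex.coe_smul, PreCorrespondence.smul_assoc_left,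
      one_smul, ip_smul_right, sub_nonneg, Complex.coe_smul] at h3
    rwa [PreCorrespondence.ip_smul_left, smul_smul]
  refine (CStarAlgebra.norm_le_norm_of_nonneg_of_le (ip_self_nonneg _) h2).trans_eq ?_
  rw [norm_smul, Real.norm_of_nonneg (by positivity)]

instance : UniformContinuousConstSMul A (Seminormed A E) :=
  Seminormed.uniformContinuous_of_norm_le A E fun a => ⟨‖a‖, fun x => by
    refine abs_le_of_sq_le_sq' ?_ (by positivity) |>.2
    rw [mul_pow, Seminormed.norm_sq_eq A, Seminormed.norm_sq_eq A]
    exact norm_ip_left_smul_le A (E := E) a x⟩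

noncomputable instance : Module A (HilbertCompletion A E) :=
  inferInstanceAs (Module A (Completion (Seminormed A E)))

instance : ContinuousConstSMul A (HilbertCompletion A E) :=
  inferInstanceAs (ContinuousConstSMul A (Completion (Seminormed A E)))

variable {E} in
theorem toCompletion_left_smul (a : A) (x : E) :
    toCompletion A (a • x) = a • toCompletion A x :=
  Completion.coe_smul (X := Seminormed A E) a x

noncomputable instance : EssentialCorrespondence A (HilbertCompletion A E) where
  smul_assoc_left c a x := by
    refine (denseRange_toCompletion A E).induction_on
      (p := fun x => (c • a) • x = c • (a • x)) x
      (isClosed_eq (continuous_const_smul _) ((continuous_const_smul c).comp (continuous_const_smul a))) (fun x => ?_)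
    rw [← toCompletion_left_smul, ← toCompletion_left_smul, ← toCompletion_smul,
      PreCorrespondence.smul_assoc_left]
  ip_smul_left a x y := by
    refine (denseRange_toCompletion A E).induction_on₂
      (p := fun x y => completionIp A (a • x) y = completionIp A x (star a • y))
      (isClosed_eq (continuous_completionIp_comp A (continuous_fst.const_smul a) (continuous_snd))
        (continuous_completionIp_comp A (continuous_fst) (continuous_snd.const_smul (star a)))) (fun x y => ?_) x y
    rw [← toCompletion_left_smul, ← toCompletion_left_smul, completionIp_coe, completionIp_coe,
      PreCorrespondence.ip_smul_left]

end LeftAction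

end PreHilbertModule

namespace PreHilbertModule

section GramMatrix

variable (A : Type u) {E : Type v} [CStarAlgebra A] [PartialOrder A] [StarOrderedRing A]
  [AddCommGroup E] [Module ℂ E] [Module Aᵐᵒᵖ E] [PreHilbertModule A E]

theorem ip_sum_right {ι : Type w} (s : Finset ι) (x : E) (y : ι → E) :
    ip A x (∑ i ∈ s, y i) = ∑ i ∈ s, ip A x (y i) :=
  map_sum (AddMonoidHom.mk' (fun y => ip A x y) (ip_add_right x)) y s

theorem ip_sum_left {ι : Type w} (s : Finset ι) (x : ι → E) (y : E) :
    ip A (∑ i ∈ s, x i) y = ∑ i ∈ s, ip A (x i) y :=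
  map_sum (AddMonoidHom.mk' (fun x => ip A x y) fun x x' => ip_add_left A x x' y) x s

/-- A selfadjoint element `G` is of the form `B⋆ * B` as soon as its negative part `N = D⋆ * D`
vanishes. -/
theorem exists_negPart_factor {R : Type w} [NonUnitalCStarAlgebra R] (G : R) (hG : star G = G) :
    ∃ N D : R, star N = N ∧ star (D * N) * (D * N) = -(N * G * N) ∧ (D * N = 0 → N = 0) ∧
      (N = 0 → ∃ B : R, G = star B * B) := by
  let _ := CStarAlgebra.spectralOrder R
  have _ := CStarAlgebra.spectralOrderedRing R
  have hG' : IsSelfAdjoint G := hG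
  have hpos := CFC.posPart_sub_negPart G hG'
  have hn : star G⁻ = G⁻ := (CFC.negPart_nonneg G).isSelfAdjoint
  obtain ⟨D, hD⟩ := CStarAlgebra.nonneg_iff_eq_star_mul_self.mp (CFC.negPart_nonneg G)
  have h1 : G⁻ * G = -(G⁻ * G⁻) := by
    calc G⁻ * G = G⁻ * (G⁺ - G⁻) := by rw [hpos]
      _ = -(G⁻ * G⁻) := by rw [mul_sub, CFC.negPart_mul_posPart, zero_sub]
  refine ⟨G⁻, D, hn, ?_, fun h => ?_, fun h => ?_⟩
  · rw [h1, star_mul, hn, neg_mul, neg_neg]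
    calc G⁻ * star D * (D * G⁻) = G⁻ * (star D * D) * G⁻ := by simp only [mul_assoc]
      _ = G⁻ * G⁻ * G⁻ := by rw [← hD]
  · have h2 : star G⁻ * G⁻ = 0 := by
      rw [hn]
      nth_rw 1 [hD]
      rw [mul_assoc, h, mul_zero]
    exact CStarRing.star_mul_self_eq_zero_iff _ |>.mp h2
  · refine CStarAlgebra.nonneg_iff_eq_star_mul_self.mp ?_
    rw [← hpos, h, sub_zero]
    exact CFC.posPart_nonneg G

theorem cstarMatrix_eq_zero_of_diag {ι : Type w} [Fintype ι] [DecidableEq ι]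
    (C : CStarMatrix ι ι A) (h : ∀ k, (star C * C) k k ≤ 0) : C = 0 := by
  ext i k
  have h1 : (star C * C) k k = ∑ l, star (C l k) * C l k := by
    simp [CStarMatrix.mul_apply, CStarMatrix.star_apply]
  have h2 : ∀ l ∈ Finset.univ, 0 ≤ star (C l k) * C l k := fun l _ => star_mul_self_nonneg _
  have h3 : ∑ l, star (C l k) * C l k = 0 :=
    le_antisymm (h1 ▸ h k) (Finset.sum_nonneg h2)
  have h4 := (Finset.sum_eq_zero_iff_of_nonneg h2).mp h3 i (Finset.mem_univ i)
  simpa using h4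

/-- Gram matrices are positive: `⟨x i, x j⟩ = ∑ k, (B k i)⋆ * B k j` for some matrix `B`. -/
theorem exists_gram_factor {ι : Type w} [Fintype ι] [DecidableEq ι] (x : ι → E) :
    ∃ B : ι → ι → A, ∀ i j, ip A (x i) (x j) = ∑ k, star (B k i) * B k j := by
  let G : CStarMatrix ι ι A := CStarMatrix.ofMatrix fun i j => ip A (x i) (x j)
  have hGe : ∀ i j, G i j = ip A (x i) (x j) := fun i j => rfl
  have hG : star G = G := by
    ext i j
    rw [CStarMatrix.star_apply, hGe, hGe, star_ip]
  obtain ⟨N, D, hN, h1, h2, h3⟩ := exists_negPart_factor G hG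
  have hNe : ∀ i j, star (N i j) = N j i := fun i j => by
    rw [← CStarMatrix.star_apply, hN]
  have h4 : D * N = 0 := by
    refine cstarMatrix_eq_zero_of_diag A _ fun k => ?_
    have h5 : (N * G * N) k k =
        ip A (∑ i, op (N i k) • x i) (∑ j, op (N j k) • x j) := by
      simp only [CStarMatrix.mul_apply, ip_sum_left, ip_sum_right, ip_op_smul_left,
        ip_op_smul_right, hGe, Finset.sum_mul, hNe, mul_assoc]
    have h6 : (star (D * N) * (D * N)) k k = -((N * G * N) k k) := by rw [h1]; rfl
    rw [h6, h5, neg_nonpos]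
    exact ip_self_nonneg _
  obtain ⟨B, hB⟩ := h3 (h2 h4)
  refine ⟨fun k i => B k i, fun i j => ?_⟩
  rw [← hGe, hB, CStarMatrix.mul_apply]
  simp only [CStarMatrix.star_apply]

end GramMatrix

end PreHilbertModule

namespace HilbertModule

open PreHilbertModule

variable (A : Type u) {E : Type v} [CStarAlgebra A] [PartialOrder A] [StarOrderedRing A]
  [NormedAddCommGroup E] [NormedSpace ℂ E] [Module Aᵐᵒᵖ E] [HilbertModule A E]

theorem eq_of_ip_right (x y : E) (h : ∀ z : E, ip A z x = ip A z y) : x = y := by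
  have h1 : ‖x - y‖ ^ 2 = 0 := by
    rw [norm_sq_eq (A := A), ip_sub_right, h, sub_self, norm_zero]
  exact sub_eq_zero.mp (norm_eq_zero.mp (pow_eq_zero_iff two_ne_zero |>.mp h1))

theorem op_smul_comm (a : A) (c : ℂ) (x : E) : op a • c • x = c • op a • x :=
  eq_of_ip_right A _ _ fun z => by
    rw [ip_op_smul_right, ip_smul_right, ip_smul_right, ip_op_smul_right, smul_mul_assoc]

end HilbertModule

namespace PreCorrespondence

variable {A : Type u} {E : Type v} [CStarAlgebra A] [PartialOrder A]
    [AddCommGroup E] [Module ℂ E] [Module Aᵐᵒᵖ E] [Module A E] [PreCorrespondence A E]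

theorem smul_comm_left (a : A) (c : ℂ) (x : E) : a • c • x = c • a • x := by
  have h : c • x = (c • (1 : A)) • x := by rw [smul_assoc_left, one_smul]
  rw [h, smul_smul, mul_smul_comm, mul_one, smul_assoc_left]

end PreCorrespondence

namespace InternalTensor

open PreHilbertModule PreCorrespondence

section Right

variable (A : Type u) (M : Type v) (X : Type w) [CStarAlgebra A] [PartialOrder A]
  [StarOrderedRing A]
  [NormedAddCommGroup M] [NormedSpace ℂ M] [Module Aᵐᵒᵖ M] [HilbertModule A M]
  [NormedAddCommGroup X] [NormedSpace ℂ X] [Module Aᵐᵒᵖ X] [Module A X]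
  [EssentialCorrespondence A X]

/-- The algebraic tensor product `M ⊙ X` over `ℂ`. -/
def Alg (_A : Type u) (M : Type v) (X : Type w) [NormedAddCommGroup M] [NormedSpace ℂ M]
    [NormedAddCommGroup X] [NormedSpace ℂ X] : Type (max v w) := M ⊗[ℂ] X

noncomputable instance : AddCommGroup (Alg A M X) := inferInstanceAs (AddCommGroup (M ⊗[ℂ] X))

noncomputable instance : Module ℂ (Alg A M X) := inferInstanceAs (Module ℂ (M ⊗[ℂ] X))

variable {A M X} in
/-- The elementary tensor `m ⊗ x` of the algebraic tensor product. -/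
def Alg.mk (m : M) (x : X) : Alg A M X := m ⊗ₜ[ℂ] x

variable {M X} in
theorem exists_sum (z : M ⊗[ℂ] X) :
    ∃ (n : ℕ) (m : Fin n → M) (x : Fin n → X), z = ∑ i, m i ⊗ₜ[ℂ] x i := by
  induction z using TensorProduct.induction_on with
  | zero => exact ⟨0, fun _ => 0, fun _ => 0, by simp⟩
  | tmul m x => exact ⟨1, fun _ => m, fun _ => x, by simp⟩
  | add y z hy hz =>
    obtain ⟨n, m, x, rfl⟩ := hy
    obtain ⟨n', m', x', rfl⟩ := hz
    refine ⟨n + n', Fin.append m m', Fin.append x x', ?_⟩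
    simp only [Fin.sum_univ_add, Fin.append_left, Fin.append_right]

/-- The map `x ↦ x · a`, as a `ℂ`-linear map. -/
def opSMul (a : Aᵐᵒᵖ) : X →ₗ[ℂ] X where
  toFun x := a • x
  map_add' := smul_add a
  map_smul' c x := HilbertModule.op_smul_comm A (unop a) c x

/-- The right action `(m ⊗ x) · a = m ⊗ (x · a)`. -/
noncomputable instance : Module Aᵐᵒᵖ (Alg A M X) where
  smul a := (opSMul A X a).lTensor M
  one_smul z := by
    change (opSMul A X 1).lTensor M z = z
    have : opSMul A X 1 = LinearMap.id := by ext x; exact one_smul _ x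
    rw [this, LinearMap.lTensor_id]; rfl
  mul_smul a b z := by
    change (opSMul A X (a * b)).lTensor M z = _
    have : opSMul A X (a * b) = opSMul A X a ∘ₗ opSMul A X b := by ext x; exact mul_smul a b x
    rw [this, LinearMap.lTensor_comp]; rfl
  smul_zero a := map_zero ((opSMul A X a).lTensor M)
  smul_add a := map_add ((opSMul A X a).lTensor M)
  add_smul a b z := by
    change (opSMul A X (a + b)).lTensor M z = _
    have : opSMul A X (a + b) = opSMul A X a + opSMul A X b := by ext x; exact add_smul a b x
    rw [this, LinearMap.lTensor_add]; rfl
  zero_smul z := by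
    change (opSMul A X 0).lTensor M z = 0
    have : opSMul A X 0 = 0 := by ext x; exact zero_smul _ x
    rw [this, LinearMap.lTensor_zero]; rfl

theorem ip_left_smul_smul (c : ℂ) (a : A) (x y : X) :
    ip A ((c • a) • x) y = star c • ip A (a • x) y := by
  rw [smul_assoc_left, ip_smul_left']

/-- The linear functional `n ⊗ y ↦ ⟨⟨n, m⟩ • x, y⟩`. -/
noncomputable def formRight (m : M) (x : X) : M ⊗[ℂ] X →ₗ[ℂ] A :=
  TensorProduct.lift (LinearMap.mk₂ ℂ (fun (n : M) (y : X) => ip A (ip A n m • x) y)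
    (fun n n' y => by rw [ip_add_left A n, add_smul, ip_add_left])
    (fun c n y => by rw [ip_smul_left', ip_left_smul_smul, star_star])
    (fun n y y' => ip_add_right _ _ _)
    (fun c n y => ip_smul_right _ _ _))

/-- The form `⟨m ⊗ x, n ⊗ y⟩ = ⟨⟨n, m⟩ • x, y⟩` on the algebraic tensor product. -/
noncomputable def form : M ⊗[ℂ] X →ₗ⋆[ℂ] M ⊗[ℂ] X →ₗ[ℂ] A :=
  TensorProduct.lift (LinearMap.mk₂'ₛₗ (starRingEnd ℂ) (starRingEnd ℂ) (formRight A M X)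
    (fun m m' x => by
      refine TensorProduct.ext' fun n y => ?_
      change ip A (ip A n (m + m') • x) y = ip A (ip A n m • x) y + ip A (ip A n m' • x) y
      rw [ip_add_right, add_smul, ip_add_left])
    (fun c m x => by
      refine TensorProduct.ext' fun n y => ?_
      change ip A (ip A n (c • m) • x) y = star c • ip A (ip A n m • x) y
      rw [ip_smul_right, ip_left_smul_smul])
    (fun m x x' => by
      refine TensorProduct.ext' fun n y => ?_
      change ip A (ip A n m • (x + x')) y = ip A (ip A n m • x) y + ip A (ip A n m • x') y
      rw [smul_add, ip_add_left])
    (fun c m x => by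
      refine TensorProduct.ext' fun n y => ?_
      change ip A (ip A n m • c • x) y = star c • ip A (ip A n m • x) y
      rw [smul_comm_left, ip_smul_left']))

theorem form_tmul (m n : M) (x y : X) :
    form A M X (m ⊗ₜ x) (n ⊗ₜ y) = ip A (ip A n m • x) y := rfl

theorem form_star (z w : M ⊗[ℂ] X) : star (form A M X z w) = form A M X w z := by
  induction w using TensorProduct.induction_on with
  | zero => rw [map_zero, map_zero, star_zero, LinearMap.zero_apply]
  | add w w' h h' => rw [map_add, map_add, star_add, h, h', LinearMap.add_apply]
  | tmul n y =>
    induction z using TensorProduct.induction_on with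
    | zero => rw [map_zero, map_zero, LinearMap.zero_apply, star_zero]
    | add w w' h h' => rw [map_add, map_add, LinearMap.add_apply, star_add, h, h']
    | tmul m x => rw [form_tmul, form_tmul, star_ip, ip_smul_left, star_ip]

theorem form_self_nonneg (z : M ⊗[ℂ] X) : 0 ≤ form A M X z z := by
  obtain ⟨n, m, x, hz⟩ := exists_sum z
  obtain ⟨B, hB⟩ := exists_gram_factor A m
  have h1 : ∀ i j, ip A (ip A (m j) (m i) • x i) (x j) =
      ∑ k, ip A (B k i • x i) (B k j • x j) := fun i j => by
    rw [hB, Finset.sum_smul, ip_sum_left]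
    refine Finset.sum_congr rfl fun k _ => ?_
    rw [mul_smul, ip_smul_left, star_star]
  have h : form A M X z z = ∑ k, ip A (∑ i, B k i • x i) (∑ j, B k j • x j) := by
    have h2 : form A M X z z = ∑ j, ∑ i, ∑ k, ip A (B k i • x i) (B k j • x j) := by
      rw [hz]
      simp only [map_sum, LinearMap.coe_sum, Finset.sum_apply, form_tmul, h1]
    rw [h2]
    simp only [ip_sum_left, ip_sum_right]
    rw [Finset.sum_comm]
    refine (Finset.sum_congr rfl fun i _ => Finset.sum_comm).trans ?_
    rw [Finset.sum_comm]
    exact Finset.sum_congr rfl fun k _ => Finset.sum_comm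
  rw [h]
  exact Finset.sum_nonneg fun k _ => ip_self_nonneg _

noncomputable instance : PreHilbertModule A (Alg A M X) where
  ip z w := form A M X z w
  ip_add_right z := map_add (form A M X z)
  ip_smul_right c z := map_smul (form A M X z) c
  ip_op_smul_right a z w := by
    change form A M X z ((opSMul A X (op a)).lTensor M w) = form A M X z w * a
    induction w using TensorProduct.induction_on with
    | zero => simp
    | add w w' h h' => rw [map_add, map_add, map_add, h, h', add_mul]
    | tmul n y =>
      induction z using TensorProduct.induction_on with
      | zero => simp
      | add w w' h h' => rw [map_add, LinearMap.add_apply, LinearMap.add_apply, h, h', add_mul]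
      | tmul m x => exact ip_op_smul_right a _ _
  star_ip := form_star A M X
  ip_self_nonneg := form_self_nonneg A M X

theorem Alg.ip_mk_mk (m n : M) (x y : X) :
    ip A (Alg.mk m x : Alg A M X) (Alg.mk n y) = ip A (ip A n m • x) y := rfl

end Right

section Left

variable (A : Type u) (M : Type v) (X : Type w) [CStarAlgebra A] [PartialOrder A]
  [StarOrderedRing A]
  [NormedAddCommGroup M] [NormedSpace ℂ M] [Module Aᵐᵒᵖ M] [Module A M]
  [EssentialCorrespondence A M]
  [NormedAddCommGroup X] [NormedSpace ℂ X] [Module Aᵐᵒᵖ X] [Module A X]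
  [EssentialCorrespondence A X]

/-- The map `m ↦ a • m`, as a `ℂ`-linear map. -/
def leftSMul (a : A) : M →ₗ[ℂ] M where
  toFun x := a • x
  map_add' := smul_add a
  map_smul' c x := smul_comm_left a c x

/-- The left action `a • (m ⊗ x) = (a • m) ⊗ x`. -/
noncomputable instance : Module A (Alg A M X) where
  smul a := (leftSMul A M a).rTensor X
  one_smul z := by
    change (leftSMul A M 1).rTensor X z = z
    have : leftSMul A M 1 = LinearMap.id := by ext x; exact one_smul _ x
    rw [this, LinearMap.rTensor_id]; rfl
  mul_smul a b z := by
    change (leftSMul A M (a * b)).rTensor X z = _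
    have : leftSMul A M (a * b) = leftSMul A M a ∘ₗ leftSMul A M b := by
      ext x; exact mul_smul a b x
    rw [this, LinearMap.rTensor_comp]; rfl
  smul_zero a := map_zero ((leftSMul A M a).rTensor X)
  smul_add a := map_add ((leftSMul A M a).rTensor X)
  add_smul a b z := by
    change (leftSMul A M (a + b)).rTensor X z = _
    have : leftSMul A M (a + b) = leftSMul A M a + leftSMul A M b := by
      ext x; exact add_smul a b x
    rw [this, LinearMap.rTensor_add]; rfl
  zero_smul z := by
    change (leftSMul A M 0).rTensor X z = 0
    have : leftSMul A M 0 = 0 := by ext x; exact zero_smul _ x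
    rw [this, LinearMap.rTensor_zero]; rfl

noncomputable instance : PreCorrespondence A (Alg A M X) where
  smul_assoc_left c a z := by
    change (leftSMul A M (c • a)).rTensor X z = c • (leftSMul A M a).rTensor X z
    have : leftSMul A M (c • a) = c • leftSMul A M a := by
      ext x; exact smul_assoc_left c a x
    rw [this, LinearMap.rTensor_smul]; rfl
  ip_smul_left a z w := by
    change form A M X ((leftSMul A M a).rTensor X z) w =
      form A M X z ((leftSMul A M (star a)).rTensor X w)
    induction w using TensorProduct.induction_on with
    | zero => simp
    | add w w' h h' => rw [map_add, map_add, map_add, h, h']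
    | tmul n y =>
      induction z using TensorProduct.induction_on with
      | zero => simp
      | add w w' h h' =>
        rw [map_add, map_add, map_add, LinearMap.add_apply, LinearMap.add_apply, h, h']
      | tmul m x =>
        change ip A (ip A n (a • m) • x) y = ip A (ip A (star a • n) m • x) y
        have h : ip A (star a • n) m = ip A n (a • m) := by rw [ip_smul_left, star_star]
        rw [h]

end Left

end InternalTensor

open PreHilbertModule

/-- The internal tensor product `M ⊗_A X`: the completion of the algebraic tensor product in the
inner product `⟨m ⊗ x, n ⊗ y⟩ = ⟨⟨n, m⟩ • x, y⟩`. -/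
abbrev InternalTensor (A : Type u) (M : Type v) (X : Type w) [CStarAlgebra A] [PartialOrder A]
    [StarOrderedRing A]
    [NormedAddCommGroup M] [NormedSpace ℂ M] [Module Aᵐᵒᵖ M] [HilbertModule A M]
    [NormedAddCommGroup X] [NormedSpace ℂ X] [Module Aᵐᵒᵖ X] [Module A X]
    [EssentialCorrespondence A X] : Type (max v w) :=
  HilbertCompletion A (InternalTensor.Alg A M X)

/-- The elementary tensor `m ⊗ x` in the internal tensor product. -/
noncomputable def InternalTensor.tmul (A : Type u) {M : Type v} {X : Type w} [CStarAlgebra A]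
    [PartialOrder A] [StarOrderedRing A]
    [NormedAddCommGroup M] [NormedSpace ℂ M] [Module Aᵐᵒᵖ M] [HilbertModule A M]
    [NormedAddCommGroup X] [NormedSpace ℂ X] [Module Aᵐᵒᵖ X] [Module A X]
    [EssentialCorrespondence A X] (m : M) (x : X) : InternalTensor A M X :=
  toCompletion A (InternalTensor.Alg.mk m x)

theorem InternalTensor.ip_tmul_tmul (A : Type u) {M : Type v} {X : Type w} [CStarAlgebra A]
    [PartialOrder A] [StarOrderedRing A]
    [NormedAddCommGroup M] [NormedSpace ℂ M] [Module Aᵐᵒᵖ M] [HilbertModule A M]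
    [NormedAddCommGroup X] [NormedSpace ℂ X] [Module Aᵐᵒᵖ X] [Module A X]
    [EssentialCorrespondence A X] (m n : M) (x y : X) :
    ip A (tmul A m x) (tmul A n y) = ip A (ip A n m • x) y :=
  ip_toCompletion A (Alg A M X) (Alg.mk m x) (Alg.mk n y)

/-- The algebra `A` as an essential correspondence over itself, with `⟨a, b⟩ = a⋆ b`. -/
noncomputable instance EssentialCorrespondence.self (A : Type u) [CStarAlgebra A] [PartialOrder A]
    [StarOrderedRing A] : EssentialCorrespondence A A where
  ip a b := star a * b
  ip_add_right _ _ _ := mul_add _ _ _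
  ip_smul_right _ _ _ := mul_smul_comm _ _ _
  ip_op_smul_right _ _ _ := (mul_assoc _ _ _).symm
  star_ip _ _ := by rw [star_mul, star_star]
  ip_self_nonneg a := star_mul_self_nonneg a
  norm_sq_eq a := by rw [pow_two, CStarRing.norm_star_mul_self]
  smul_assoc_left _ _ _ := smul_mul_assoc _ _ _
  ip_smul_left a x y := by
    change star (a * x) * y = star x * (star a * y)
    rw [star_mul, mul_assoc]

/-- A bundled essential correspondence. -/
structure BundledCorrespondence (A : Type u) [CStarAlgebra A] [PartialOrder A] where
  carrier : Type u
  [normedAddCommGroup : NormedAddCommGroup carrier]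
  [normedSpace : NormedSpace ℂ carrier]
  [rightModule : Module Aᵐᵒᵖ carrier]
  [leftModule : Module A carrier]
  [correspondence : EssentialCorrespondence A carrier]

attribute [instance] BundledCorrespondence.normedAddCommGroup BundledCorrespondence.normedSpace
  BundledCorrespondence.rightModule BundledCorrespondence.leftModule
  BundledCorrespondence.correspondence

section TensorPow

variable (A : Type u) [CStarAlgebra A] [PartialOrder A] [StarOrderedRing A]
  (M : Type u) [NormedAddCommGroup M] [NormedSpace ℂ M] [Module Aᵐᵒᵖ M] [Module A M]
  [EssentialCorrespondence A M]

/-- The tensor powers `M^{⊗0} = A` and `M^{⊗(k+1)} = M ⊗_A M^{⊗k}`. -/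
noncomputable def tensorPowBundled : ℕ → BundledCorrespondence A
  | 0 => ⟨A⟩
  | k + 1 => ⟨InternalTensor A M (tensorPowBundled k).carrier⟩

/-- The space of the correspondence `M^{⊗k}`. -/
abbrev TensorPow (k : ℕ) : Type u := (tensorPowBundled A M k).carrier

variable {M}

/-- The element `m ⊗ x` of `M^{⊗(k+1)}`, for `m` in `M` and `x` in `M^{⊗k}`. -/
noncomputable def tensorCons {k : ℕ} (m : M) (x : TensorPow A M k) : TensorPow A M (k + 1) :=
  InternalTensor.tmul A m x

theorem ip_tensorCons {k : ℕ} (m n : M) (x y : TensorPow A M k) :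
    ip A (tensorCons A m x) (tensorCons A n y) = ip A (ip A n m • x) y :=
  InternalTensor.ip_tmul_tmul A m n x y

/-- The element `m (j 0) ⊗ ⋯ ⊗ m (j (k - 1))` of `M^{⊗k}`, which is `1` in `M^{⊗0} = A` if `k = 0`
(and the element `m (j 0) ⊗ 1` of `M ⊗_A A ≅ M` if `k = 1`). -/
noncomputable def tensorWord {J : Type w} (m : J → M) :
    (k : ℕ) → (Fin k → J) → TensorPow A M k
  | 0, _ => (1 : A)
  | k + 1, j => tensorCons A (m (j 0)) (tensorWord m k (Fin.tail j))

end TensorPow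

/-- Inner-product preserving maps of Hilbert modules. (Linearity over `ℂ` and `A` is automatic.) -/
structure IsometricMap (A : Type u) (E : Type v) (F : Type w) [CStarAlgebra A] [PartialOrder A]
    [NormedAddCommGroup E] [NormedSpace ℂ E] [Module Aᵐᵒᵖ E] [HilbertModule A E]
    [NormedAddCommGroup F] [NormedSpace ℂ F] [Module Aᵐᵒᵖ F] [HilbertModule A F] where
  toFun : E → F
  ip_map' (x y : E) : ip A (toFun x) (toFun y) = ip A x y

namespace IsometricMap

section

variable {A : Type u} {E : Type v} {F : Type w} [CStarAlgebra A] [PartialOrder A]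
    [NormedAddCommGroup E] [NormedSpace ℂ E] [Module Aᵐᵒᵖ E] [HilbertModule A E]
    [NormedAddCommGroup F] [NormedSpace ℂ F] [Module Aᵐᵒᵖ F] [HilbertModule A F]

instance : FunLike (IsometricMap A E F) E F where
  coe := toFun
  coe_injective f g h := by cases f; cases g; congr

theorem ip_map (T : IsometricMap A E F) (x y : E) : ip A (T x) (T y) = ip A x y :=
  T.ip_map' x y

variable [StarOrderedRing A]

theorem eq_zero_of_ip_self {x : F} (h : ip A x x = 0) : x = 0 := by
  have h1 : ‖x‖ ^ 2 = 0 := by rw [HilbertModule.norm_sq_eq (A := A), h, norm_zero]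
  exact norm_eq_zero.mp (pow_eq_zero_iff two_ne_zero |>.mp h1)

instance : LinearMapClass (IsometricMap A E F) ℂ E F where
  map_add T x y := by
    refine sub_eq_zero.mp (eq_zero_of_ip_self (A := A) ?_)
    simp only [ip_sub_left, ip_sub_right, ip_add_left, ip_add_right, ip_map]
    abel
  map_smulₛₗ T c x := by
    refine sub_eq_zero.mp (eq_zero_of_ip_self (A := A) ?_)
    simp only [ip_sub_left, ip_sub_right, ip_smul_left', ip_smul_right, ip_map, RingHom.id_apply,
      sub_self, smul_zero, smul_comm c (star c)]

instance : LinearMapClass (IsometricMap A E F) Aᵐᵒᵖ E F where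
  map_add := map_add
  map_smulₛₗ T c x := by
    obtain ⟨a, rfl⟩ := op_surjective c
    refine sub_eq_zero.mp (eq_zero_of_ip_self (A := A) ?_)
    simp only [ip_sub_left, ip_sub_right, ip_op_smul_left, ip_op_smul_right, ip_map,
      RingHom.id_apply, mul_assoc, sub_self, zero_mul]

end

end IsometricMap

/-- The map `T_k n = m₀ ⊗ n` from `M^{⊗k}` to `M^{⊗(k+1)}` given by a vector with
`⟨m₀, m₀⟩ = 1`. -/
noncomputable def tensorMap (A : Type u) [CStarAlgebra A] [PartialOrder A] [StarOrderedRing A]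
    {M : Type u} [NormedAddCommGroup M] [NormedSpace ℂ M] [Module Aᵐᵒᵖ M] [Module A M]
    [EssentialCorrespondence A M] (m₀ : M) (h₀ : ip A m₀ m₀ = 1) (k : ℕ) :
    IsometricMap A (TensorPow A M k) (TensorPow A M (k + 1)) where
  toFun n := tensorCons A m₀ n
  ip_map' x y := by rw [ip_tensorCons, h₀, one_smul]

namespace HilbertLimit

variable {A : Type u} [CStarAlgebra A] [PartialOrder A] [StarOrderedRing A]
  {X : ℕ → Type v} [∀ k, NormedAddCommGroup (X k)] [∀ k, NormedSpace ℂ (X k)]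
  [∀ k, Module Aᵐᵒᵖ (X k)] [∀ k, HilbertModule A (X k)]
  (T : ∀ k, IsometricMap A (X k) (X (k + 1)))

/-- The composition `X i → X (i + 1) → ⋯ → X j` of the maps `T`. -/
def transition (i j : ℕ) (h : i ≤ j) : IsometricMap A (X i) (X j) :=
  Nat.leRec (motive := fun j _ => IsometricMap A (X i) (X j))
    ⟨fun x => x, fun _ _ => rfl⟩
    (fun k _ S => ⟨fun x => T k (S x), fun x y => by rw [IsometricMap.ip_map, S.ip_map]⟩) h

theorem transition_self (i : ℕ) (x : X i) : transition T i i le_rfl x = x := by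
  rw [transition, Nat.leRec_self]
  rfl

theorem transition_succ (i j : ℕ) (h : i ≤ j) (x : X i) :
    transition T i (j + 1) (h.trans j.le_succ) x = T j (transition T i j h x) := by
  rw [transition, Nat.leRec_succ _ _ h]
  rfl

instance : DirectedSystem X (transition T · · ·) where
  map_self i x := transition_self T i x
  map_map k j i hij hjk x := by
    induction k, hjk using Nat.le_induction with
    | base => exact transition_self T j _
    | succ k hjk ih =>
      rw [transition_succ T j k hjk, transition_succ T i k (hij.trans hjk)]
      exact congrArg (T k) ih

/-- The quotient of the disjoint union of the `X k` which identifies `x` with `T k x`. -/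
def Alg : Type v := DirectLimit X (transition T)

noncomputable instance : AddCommGroup (Alg T) :=
  inferInstanceAs (AddCommGroup (DirectLimit X (transition T)))

noncomputable instance : Module ℂ (Alg T) :=
  inferInstanceAs (Module ℂ (DirectLimit X (transition T)))

noncomputable instance : Module Aᵐᵒᵖ (Alg T) :=
  inferInstanceAs (Module Aᵐᵒᵖ (DirectLimit X (transition T)))

/-- The class of `x` in `X k`. -/
def Alg.mk (k : ℕ) (x : X k) : Alg T := (⟦⟨k, x⟩⟧ : DirectLimit X (transition T))

/-- The inner product `⟨[x], [y]⟩ = ⟨x, y⟩` for `x` and `y` in the same `X k`. -/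
noncomputable def Alg.ip (z w : Alg T) : A :=
  DirectLimit.lift₂ (transition T) (transition T) (fun _ x y => PreHilbertModule.ip A x y)
    (fun i j h x y => ((transition T i j h).ip_map x y).symm) z w

theorem Alg.ip_mk_mk (k : ℕ) (x y : X k) :
    Alg.ip T (Alg.mk T k x) (Alg.mk T k y) = PreHilbertModule.ip A x y :=
  DirectLimit.lift₂_def ..

theorem Alg.exists_mk (z : Alg T) : ∃ k x, z = Alg.mk T k x :=
  DirectLimit.exists_eq_mk (transition T) z

theorem Alg.exists_mk₂ (z w : Alg T) : ∃ k x y, z = Alg.mk T k x ∧ w = Alg.mk T k y :=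
  DirectLimit.exists_eq_mk₂ (transition T) z w

theorem Alg.exists_mk₃ (z w t : Alg T) :
    ∃ k x y s, z = Alg.mk T k x ∧ w = Alg.mk T k y ∧ t = Alg.mk T k s :=
  DirectLimit.exists_eq_mk₃ (transition T) z w t

theorem Alg.mk_add (k : ℕ) (x y : X k) : Alg.mk T k (x + y) = Alg.mk T k x + Alg.mk T k y :=
  (DirectLimit.add_def (f := transition T) k x y).symm

theorem Alg.mk_smul (k : ℕ) (c : ℂ) (x : X k) : Alg.mk T k (c • x) = c • Alg.mk T k x := rfl

theorem Alg.mk_op_smul (k : ℕ) (c : Aᵐᵒᵖ) (x : X k) : Alg.mk T k (c • x) = c • Alg.mk T k x :=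
  rfl

theorem Alg.mk_map (k : ℕ) (x : X k) : Alg.mk T (k + 1) (T k x) = Alg.mk T k x := by
  have h := DirectLimit.mk_apply (f := transition T) k (k + 1) x k.le_succ
  have h1 := transition_succ T k k le_rfl x
  rw [transition_self] at h1
  rw [← h1]
  exact h

noncomputable instance : PreHilbertModule A (Alg T) where
  ip := Alg.ip T
  ip_add_right z w t := by
    obtain ⟨k, x, y, s, rfl, rfl, rfl⟩ := Alg.exists_mk₃ T z w t
    rw [← Alg.mk_add, Alg.ip_mk_mk, Alg.ip_mk_mk, Alg.ip_mk_mk, ip_add_right]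
  ip_smul_right c z w := by
    obtain ⟨k, x, y, rfl, rfl⟩ := Alg.exists_mk₂ T z w
    rw [← Alg.mk_smul, Alg.ip_mk_mk, Alg.ip_mk_mk, ip_smul_right]
  ip_op_smul_right a z w := by
    obtain ⟨k, x, y, rfl, rfl⟩ := Alg.exists_mk₂ T z w
    rw [← Alg.mk_op_smul, Alg.ip_mk_mk, Alg.ip_mk_mk, ip_op_smul_right]
  star_ip z w := by
    obtain ⟨k, x, y, rfl, rfl⟩ := Alg.exists_mk₂ T z w
    rw [Alg.ip_mk_mk, Alg.ip_mk_mk, star_ip]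
  ip_self_nonneg z := by
    obtain ⟨k, x, rfl⟩ := Alg.exists_mk T z
    rw [Alg.ip_mk_mk]
    exact ip_self_nonneg x

end HilbertLimit

/-- The direct limit of a sequence of Hilbert modules and inner-product preserving maps: the
completion of the quotient of the disjoint union of the `X k` which identifies `x` with `T k x`. -/
abbrev HilbertLimit {A : Type u} [CStarAlgebra A] [PartialOrder A] [StarOrderedRing A]
    {X : ℕ → Type v} [∀ k, NormedAddCommGroup (X k)] [∀ k, NormedSpace ℂ (X k)]
    [∀ k, Module Aᵐᵒᵖ (X k)] [∀ k, HilbertModule A (X k)]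
    (T : ∀ k, IsometricMap A (X k) (X (k + 1))) : Type v :=
  HilbertCompletion A (HilbertLimit.Alg T)

/-- The canonical maps `ι^k` from `X k` to the direct limit. -/
noncomputable def HilbertLimit.ι {A : Type u} [CStarAlgebra A] [PartialOrder A] [StarOrderedRing A]
    {X : ℕ → Type v} [∀ k, NormedAddCommGroup (X k)] [∀ k, NormedSpace ℂ (X k)]
    [∀ k, Module Aᵐᵒᵖ (X k)] [∀ k, HilbertModule A (X k)]
    (T : ∀ k, IsometricMap A (X k) (X (k + 1))) (k : ℕ) : IsometricMap A (X k) (HilbertLimit T) where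
  toFun x := toCompletion A (HilbertLimit.Alg.mk T k x)
  ip_map' x y := by
    rw [ip_toCompletion]
    exact HilbertLimit.Alg.ip_mk_mk T k x y

theorem HilbertLimit.ι_map {A : Type u} [CStarAlgebra A] [PartialOrder A] [StarOrderedRing A]
    {X : ℕ → Type v} [∀ k, NormedAddCommGroup (X k)] [∀ k, NormedSpace ℂ (X k)]
    [∀ k, Module Aᵐᵒᵖ (X k)] [∀ k, HilbertModule A (X k)]
    (T : ∀ k, IsometricMap A (X k) (X (k + 1))) (k : ℕ) (x : X k) :
    HilbertLimit.ι T (k + 1) (T k x) = HilbertLimit.ι T k x :=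
  congrArg (toCompletion A) (HilbertLimit.Alg.mk_map T k x)

section Frames

variable (A : Type u) {E : Type v} [CStarAlgebra A] [PartialOrder A]
  [NormedAddCommGroup E] [NormedSpace ℂ E] [Module Aᵐᵒᵖ E] [HilbertModule A E]

/-- The family `x` is a Parseval frame: `⟨z, z⟩ = ∑ j, ⟨z, x j⟩ ⟨x j, z⟩` for every `z`, with
convergence in norm of the net of finite partial sums. -/
def IsParsevalFrame {J : Type w} (x : J → E) : Prop :=
  ∀ z : E, HasSum (fun j => ip A z (x j) * ip A (x j) z) (ip A z z)

/-- The family `x` is an orthonormal basis: `⟨x i, x j⟩` is `1` for `i = j` and `0` otherwise, and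
the `x j` generate the Hilbert module, i.e. the `A`-linear combinations of them are dense. -/
def IsOrthonormalBasis {J : Type w} (x : J → E) : Prop :=
  (∀ i, ip A (x i) (x i) = 1) ∧ (∀ i j, i ≠ j → ip A (x i) (x j) = 0) ∧
    Dense (Submodule.span Aᵐᵒᵖ (Set.range x) : Set E)

end Frames

section Main

variable (A : Type u) [CStarAlgebra A] [PartialOrder A] [StarOrderedRing A]
  {M : Type u} [NormedAddCommGroup M] [NormedSpace ℂ M] [Module Aᵐᵒᵖ M] [Module A M]
  [EssentialCorrespondence A M]

/-- The direct limit `M_∞` of the tensor powers `M^{⊗k}` along the maps `T_k n = m₀ ⊗ n`. -/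
abbrev MInfty (m₀ : M) (h₀ : ip A m₀ m₀ = 1) : Type u :=
  HilbertLimit (tensorMap A m₀ h₀)

/-- The family consisting of `ι^0(1)` and of the vectors `ι^k(m (j 1) ⊗ ⋯ ⊗ m (j k))` with `k ≥ 1`
and `j 1 ≠ j₀`. (Here `k` is written as `k + 1`, and the indices start from `0`.) -/
noncomputable def limitFamily {J : Type w} (m : J → M) (j₀ : J) (h₀ : ip A (m j₀) (m j₀) = 1) :
    Option (Σ k : ℕ, {j : Fin (k + 1) → J // j 0 ≠ j₀}) → MInfty A (m j₀) h₀
  | none => HilbertLimit.ι (tensorMap A (m j₀) h₀) 0 (1 : A)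
  | some ⟨k, j⟩ => HilbertLimit.ι (tensorMap A (m j₀) h₀) (k + 1) (tensorWord A m (k + 1) j)

end Main

/-!
A Parseval frame reconstructs every vector, so expanding the first factors of a tensor shows that
the `m j ⊗ x k` are a Parseval frame of `M ⊗_A X`; inductively the words of length `k` form one of
`M^{⊗k}`. In `M_∞` leading letters `j₀` are absorbed by the connecting maps, so `ι^k` carries these
words bijectively onto the members of the limit family of length at most `k`. The longer members
are orthogonal to `ι^k(M^{⊗k})`: the Parseval identity at the unit vector `m j₀` leaves no room for
the other letters, so `⟨m j, m j₀⟩ = 0` for `j ≠ j₀`. Hence the Parseval identity holds on the dense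
union of the `ι^k(M^{⊗k})`, and it extends to `M_∞` because the errors of the partial frame
expansions are contractions.
-/

section PositiveSums

variable {A : Type*} [NonUnitalCStarAlgebra A] [PartialOrder A] [StarOrderedRing A]
  {ι κ : Type*}

/-- Increasing nets converge as soon as they accumulate at an upper bound, because the norm of a
C⋆-algebra is monotone on positive elements. -/
theorem hasSum_of_nonneg_of_mem_closure {f : ι → A} {c : A} (hf : ∀ i, 0 ≤ f i)
    (hle : ∀ s : Finset ι, ∑ i ∈ s, f i ≤ c)
    (hc : c ∈ closure (Set.range fun s : Finset ι => ∑ i ∈ s, f i)) : HasSum f c := by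
  classical
  rw [HasSum, SummationFilter.unconditional_filter, Metric.tendsto_atTop]
  intro ε hε
  obtain ⟨_, ⟨s, rfl⟩, hs⟩ := Metric.mem_closure_iff.mp hc ε hε
  refine ⟨s, fun t hst => ?_⟩
  rw [dist_comm]
  rw [dist_eq_norm] at hs ⊢
  refine (CStarAlgebra.norm_le_norm_of_nonneg_of_le (sub_nonneg.mpr (hle t)) ?_).trans_lt hs
  exact sub_le_sub_left (Finset.sum_le_sum_of_subset_of_nonneg hst fun i _ _ => hf i) c

theorem hasSum_prod_of_nonneg {f : ι × κ → A} {g : ι → A} {c : A} (hf : ∀ p, 0 ≤ f p)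
    (hg : ∀ i, HasSum (fun j => f (i, j)) (g i)) (hc : HasSum g c) : HasSum f c := by
  classical
  have hg_nonneg : ∀ i, 0 ≤ g i := fun i => (hg i).nonneg fun j => hf (i, j)
  refine hasSum_of_nonneg_of_mem_closure hf (fun s => ?_) ?_
  · calc ∑ p ∈ s, f p ≤ ∑ p ∈ s.image Prod.fst ×ˢ s.image Prod.snd, f p :=
          Finset.sum_le_sum_of_subset_of_nonneg Finset.subset_product fun p _ _ => hf p
      _ = ∑ i ∈ s.image Prod.fst, ∑ j ∈ s.image Prod.snd, f (i, j) := Finset.sum_product _ _ _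
      _ ≤ ∑ i ∈ s.image Prod.fst, g i :=
          Finset.sum_le_sum fun i _ => sum_le_hasSum _ (fun j _ => hf (i, j)) (hg i)
      _ ≤ c := sum_le_hasSum _ (fun i _ => hg_nonneg i) hc
  · have hpartial : ∀ s : Finset ι,
        ∑ i ∈ s, g i ∈ closure (Set.range fun r : Finset (ι × κ) => ∑ p ∈ r, f p) := fun s =>
      mem_closure_of_tendsto (hasSum_sum fun i _ => hg i) <| Filter.Eventually.of_forall fun t =>
        ⟨s ×ˢ t, Finset.sum_product_right _ _ _⟩
    exact isClosed_closure.mem_of_tendsto hc (Filter.Eventually.of_forall hpartial)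

end PositiveSums

section InnerProduct

variable (A : Type*) [CStarAlgebra A] [PartialOrder A] [StarOrderedRing A]

theorem ip_mul_ip_nonneg {E : Type*} [AddCommGroup E] [Module ℂ E] [Module Aᵐᵒᵖ E]
    [PreHilbertModule A E] (x z : E) : 0 ≤ ip A z x * ip A x z := by
  rw [← star_ip]
  exact star_mul_self_nonneg _

variable {E : Type*} [NormedAddCommGroup E] [NormedSpace ℂ E] [Module Aᵐᵒᵖ E]

theorem norm_ip_le_norm_mul_norm [HilbertModule A E] (x y : E) : ‖ip A x y‖ ≤ ‖x‖ * ‖y‖ := by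
  refine abs_le_of_sq_le_sq' ?_ (by positivity) |>.2
  rw [mul_pow, HilbertModule.norm_sq_eq (A := A) x, HilbertModule.norm_sq_eq (A := A) y]
  exact norm_ip_sq_le A x y

theorem norm_left_smul_le [Module A E] [EssentialCorrespondence A E] (a : A) (x : E) :
    ‖a • x‖ ≤ ‖a‖ * ‖x‖ := by
  refine abs_le_of_sq_le_sq' ?_ (by positivity) |>.2
  rw [mul_pow, HilbertModule.norm_sq_eq (A := A) x, HilbertModule.norm_sq_eq (A := A) (a • x)]
  exact norm_ip_left_smul_le A a x

/-- The inner product of a Hilbert module as a continuous sesquilinear map. -/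
noncomputable def ipSL [HilbertModule A E] : E →L⋆[ℂ] E →L[ℂ] A :=
  LinearMap.mkContinuous₂
    (LinearMap.mk₂'ₛₗ (starRingEnd ℂ) (RingHom.id ℂ) (fun x y => ip A x y)
      (ip_add_left A) (ip_smul_left' A) ip_add_right ip_smul_right) 1 fun x y =>
    (norm_ip_le_norm_mul_norm A x y).trans_eq (by rw [one_mul])

@[simp]
theorem ipSL_apply [HilbertModule A E] (x y : E) : ipSL A x y = ip A x y := rfl

theorem continuous_ip [HilbertModule A E] : Continuous fun p : E × E => ip A p.1 p.2 :=
  ((ipSL A).continuous.comp continuous_fst).clm_apply continuous_snd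

/-- The orbit map `a ↦ a • x` of the left action on an essential correspondence. -/
noncomputable def leftOrbitCLM [Module A E] [EssentialCorrespondence A E] (x : E) : A →L[ℂ] E :=
  LinearMap.mkContinuous
    { toFun := fun a => a • x
      map_add' := fun a b => add_smul a b x
      map_smul' := fun c a => PreCorrespondence.smul_assoc_left c a x } ‖x‖ fun a =>
    (norm_left_smul_le A a x).trans_eq (mul_comm _ _)

@[simp]
theorem leftOrbitCLM_apply [Module A E] [EssentialCorrespondence A E] (x : E) (a : A) :
    leftOrbitCLM A x a = a • x := rfl

end InnerProduct

section Bessel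

variable (A : Type*) [CStarAlgebra A] [PartialOrder A]
  {E : Type*} [AddCommGroup E] [Module ℂ E] [Module Aᵐᵒᵖ E] [PreHilbertModule A E] {J : Type*}

/-- A Bessel family: the partial sums of Parseval's identity do not exceed `⟨z, z⟩`. -/
def IsBessel (x : J → E) : Prop :=
  ∀ (s : Finset J) (z : E), ∑ j ∈ s, ip A z (x j) * ip A (x j) z ≤ ip A z z

/-- The error `z - ∑ j ∈ s, x j · ⟨x j, z⟩` of a partial frame expansion of `z`. -/
def expansionError (x : J → E) (s : Finset J) (z : E) : E :=
  z - ∑ j ∈ s, op (ip A (x j) z) • x j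

variable [StarOrderedRing A] {A}

theorem expansionError_sub (x : J → E) (s : Finset J) (y z : E) :
    expansionError A x s (y - z) = expansionError A x s y - expansionError A x s z := by
  simp only [expansionError, ip_sub_right, op_sub, sub_smul, Finset.sum_sub_distrib]
  abel

theorem ip_expansionError (x : J → E) (s : Finset J) (y z : E) :
    ip A y (expansionError A x s z) = ip A y z - ∑ j ∈ s, ip A y (x j) * ip A (x j) z := by
  simp only [expansionError, ip_sub_right, ip_sum_right, ip_op_smul_right]

theorem ip_expansionError_self_le (x : J → E) (s : Finset J) (z : E) :
    ip A z (expansionError A x s z) ≤ ip A z z := by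
  rw [ip_expansionError]
  exact sub_le_self _ (Finset.sum_nonneg fun j _ => ip_mul_ip_nonneg A (x j) z)

namespace IsBessel

variable {x : J → E}

theorem ip_expansionError_self_nonneg (hx : IsBessel A x) (s : Finset J) (z : E) :
    0 ≤ ip A z (expansionError A x s z) := by
  rw [ip_expansionError]
  exact sub_nonneg.mpr (hx s z)

/-- The semi-inner product `⟨y, E z⟩`, where `E` is the expansion error of a Bessel family. It makes
the Cauchy–Schwarz inequality available for `E`. -/
abbrev errorModule (hx : IsBessel A x) (s : Finset J) : PreHilbertModule A E where
  ip y z := ip A y (expansionError A x s z)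
  ip_add_right y z w := by
    simp only [ip_expansionError, ip_add_right, mul_add, Finset.sum_add_distrib]
    abel
  ip_smul_right c y z := by
    simp only [ip_expansionError, ip_smul_right, mul_smul_comm, smul_sub, Finset.smul_sum]
  ip_op_smul_right a y z := by
    simp only [ip_expansionError, ip_op_smul_right, sub_mul, Finset.sum_mul, mul_assoc]
  star_ip y z := by
    simp only [ip_expansionError, star_sub, star_sum, star_mul, star_ip]
  ip_self_nonneg := hx.ip_expansionError_self_nonneg s

theorem ip_eq_zero_of_ip_self_eq_one (hx : IsBessel A x) {i j : J} (hi : ip A (x i) (x i) = 1)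
    (hij : i ≠ j) : ip A (x j) (x i) = 0 := by
  classical
  have h := hx {i, j} (x i)
  rw [Finset.sum_pair hij, hi, mul_one, ← star_ip (x j), add_le_iff_nonpos_right] at h
  exact (CStarRing.star_mul_self_eq_zero_iff _).mp (le_antisymm h (star_mul_self_nonneg _))

end IsBessel

end Bessel

section ParsevalFrames

variable {A : Type*} [CStarAlgebra A] [PartialOrder A]
  {E : Type*} [NormedAddCommGroup E] [NormedSpace ℂ E] [Module Aᵐᵒᵖ E] [HilbertModule A E]
  {J : Type*} {x : J → E}

theorem hasSum_smul_iff_tendsto_expansionError {z : E} :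
    HasSum (fun j => op (ip A (x j) z) • x j) z ↔
      Filter.Tendsto (fun s => expansionError A x s z) Filter.atTop (nhds 0) := by
  rw [HasSum, SummationFilter.unconditional_filter, ← tendsto_sub_nhds_zero_iff,
    ← tendsto_neg_iff, neg_zero]
  simp only [expansionError, neg_sub]

variable [StarOrderedRing A]

theorem IsBessel.norm_ip_expansionError_self_le (hx : IsBessel A x) (s : Finset J) (z : E) :
    ‖ip A z (expansionError A x s z)‖ ≤ ‖z‖ ^ 2 := by
  rw [HilbertModule.norm_sq_eq (A := A)]
  exact CStarAlgebra.norm_le_norm_of_nonneg_of_le (hx.ip_expansionError_self_nonneg s z)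
    (ip_expansionError_self_le x s z)

theorem IsBessel.norm_expansionError_sq_le (hx : IsBessel A x) (s : Finset J) (z : E) :
    ‖expansionError A x s z‖ ^ 2 ≤ ‖ip A z (expansionError A x s z)‖ := by
  set v := expansionError A x s z
  rcases eq_or_ne v 0 with hv | hv
  · simp only [hv, norm_zero, zero_pow two_ne_zero, norm_nonneg]
  have cauchySchwarz :
      ‖ip A v v‖ ^ 2 ≤ ‖ip A v (expansionError A x s v)‖ * ‖ip A z v‖ :=
    @norm_ip_sq_le A E _ _ _ _ _ _ (hx.errorModule s) v z
  refine le_of_mul_le_mul_left ?_ (pow_pos (norm_pos_iff.mpr hv) 2)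
  calc ‖v‖ ^ 2 * ‖v‖ ^ 2 = ‖ip A v v‖ ^ 2 := by rw [HilbertModule.norm_sq_eq (A := A), sq]
    _ ≤ ‖ip A v (expansionError A x s v)‖ * ‖ip A z v‖ := cauchySchwarz
    _ ≤ ‖v‖ ^ 2 * ‖ip A z v‖ := by
      gcongr
      exact hx.norm_ip_expansionError_self_le s v

theorem IsBessel.lipschitzWith_expansionError (hx : IsBessel A x) (s : Finset J) :
    LipschitzWith 1 (expansionError A x s) := by
  refine LipschitzWith.of_dist_le_mul fun y z => ?_
  rw [dist_eq_norm, dist_eq_norm, ← expansionError_sub, NNReal.coe_one, one_mul]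
  exact abs_le_of_sq_le_sq' ((hx.norm_expansionError_sq_le s _).trans
    (hx.norm_ip_expansionError_self_le s _)) (norm_nonneg _) |>.2

theorem isBessel_of_dense {D : Set E} (hD : Dense D)
    (h : ∀ (s : Finset J), ∀ z ∈ D, ∑ j ∈ s, ip A z (x j) * ip A (x j) z ≤ ip A z z) :
    IsBessel A x := fun s z => by
  have hclosed : IsClosed {z : E | ∑ j ∈ s, ip A z (x j) * ip A (x j) z ≤ ip A z z} :=
    isClosed_le
      (continuous_finsetSum s fun j _ =>
        ((continuous_ip A).comp (continuous_id.prodMk continuous_const)).mul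
          ((continuous_ip A).comp (continuous_const.prodMk continuous_id)))
      ((continuous_ip A).comp (continuous_id.prodMk continuous_id))
  exact hclosed.closure_subset_iff.mpr (h s) (hD z)

theorem IsBessel.hasSum_smul_of_hasSum_ip (hx : IsBessel A x) {z : E}
    (hz : HasSum (fun j => ip A z (x j) * ip A (x j) z) (ip A z z)) :
    HasSum (fun j => op (ip A (x j) z) • x j) z := by
  rw [hasSum_smul_iff_tendsto_expansionError]
  rw [HasSum, SummationFilter.unconditional_filter] at hz
  have hip : Filter.Tendsto (fun s => ‖ip A z (expansionError A x s z)‖) Filter.atTop (nhds 0) := by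
    simpa only [ip_expansionError, sub_self, norm_zero] using (hz.const_sub (ip A z z)).norm
  have hsq := squeeze_zero (fun _ => sq_nonneg _) (fun s => hx.norm_expansionError_sq_le s z) hip
  rw [tendsto_zero_iff_norm_tendsto_zero]
  simpa only [Real.sqrt_sq (norm_nonneg _), Real.sqrt_zero] using hsq.sqrt

namespace IsParsevalFrame

theorem isBessel (hx : IsParsevalFrame A x) : IsBessel A x := fun s z =>
  sum_le_hasSum s (fun j _ => ip_mul_ip_nonneg A (x j) z) (hx z)

theorem hasSum_smul (hx : IsParsevalFrame A x) (z : E) :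
    HasSum (fun j => op (ip A (x j) z) • x j) z :=
  hx.isBessel.hasSum_smul_of_hasSum_ip (hx z)

theorem hasSum_ip (hx : IsParsevalFrame A x) (y z : E) :
    HasSum (fun j => ip A y (x j) * ip A (x j) z) (ip A y z) := by
  simpa only [ipSL_apply, ip_op_smul_right] using (ipSL A y).hasSum (hx.hasSum_smul z)

theorem dense_span (hx : IsParsevalFrame A x) :
    Dense (Submodule.span Aᵐᵒᵖ (Set.range x) : Set E) := fun z =>
  mem_closure_of_tendsto (hx.hasSum_smul z) <| Filter.Eventually.of_forall fun _ =>
    Submodule.sum_mem _ fun j _ => Submodule.smul_mem _ _ (Submodule.subset_span ⟨j, rfl⟩)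

/-- The partial expansion errors of a Bessel family are contractions, hence equicontinuous, so they
tend to zero everywhere once they do so on a dense set. -/
theorem of_dense {D : Set E} (hD : Dense D)
    (h : ∀ z ∈ D, HasSum (fun j => ip A z (x j) * ip A (x j) z) (ip A z z)) :
    IsParsevalFrame A x := by
  have hx : IsBessel A x := isBessel_of_dense hD fun s z hz =>
    sum_le_hasSum s (fun j _ => ip_mul_ip_nonneg A (x j) z) (h z hz)
  have hclosed : IsClosed {z : E | Filter.Tendsto (fun s => expansionError A x s z) Filter.atTop
      (nhds 0)} :=
    (LipschitzWith.uniformEquicontinuous (expansionError A x) 1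
      hx.lipschitzWith_expansionError).equicontinuous.isClosed_setOfPred_tendsto continuous_const
  intro z
  have hz := hclosed.closure_subset_iff.mpr (fun z hz =>
    hasSum_smul_iff_tendsto_expansionError.mp (hx.hasSum_smul_of_hasSum_ip (h z hz))) (hD z)
  simpa only [ipSL_apply, ip_op_smul_right] using
    (ipSL A z).hasSum (hasSum_smul_iff_tendsto_expansionError.mpr hz)

end IsParsevalFrame

end ParsevalFrames

section FramesAndOrthonormalFamilies

/-- An orthonormal family in a Hilbert module: an orthonormal basis without the density
condition. -/
def IsOrthonormalFamily (A : Type*) [CStarAlgebra A] [PartialOrder A] {E : Type*} [AddCommGroup E]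
    [Module ℂ E] [Module Aᵐᵒᵖ E] [PreHilbertModule A E] {J : Type*} (x : J → E) : Prop :=
  (∀ i, ip A (x i) (x i) = 1) ∧ ∀ i j, i ≠ j → ip A (x i) (x j) = 0

variable {A : Type*} [CStarAlgebra A] [PartialOrder A]
  {E : Type*} [NormedAddCommGroup E] [NormedSpace ℂ E] [Module Aᵐᵒᵖ E] [HilbertModule A E]
  {J K : Type*} {x : J → E}

theorem IsOrthonormalFamily.comp_injective (hx : IsOrthonormalFamily A x) {e : K → J}
    (he : Function.Injective e) : IsOrthonormalFamily A (x ∘ e) :=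
  ⟨fun i => hx.1 (e i), fun i j hij => hx.2 (e i) (e j) (he.ne hij)⟩

theorem IsOrthonormalBasis.isOrthonormalFamily (hx : IsOrthonormalBasis A x) :
    IsOrthonormalFamily A x :=
  ⟨hx.1, hx.2.1⟩

theorem IsParsevalFrame.comp_equiv (hx : IsParsevalFrame A x) (e : K ≃ J) :
    IsParsevalFrame A (x ∘ e) := fun z =>
  e.hasSum_iff.mpr (hx z)

theorem IsParsevalFrame.isOrthonormalBasis [StarOrderedRing A] (hx : IsParsevalFrame A x)
    (ho : IsOrthonormalFamily A x) : IsOrthonormalBasis A x :=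
  ⟨ho.1, ho.2, hx.dense_span⟩

end FramesAndOrthonormalFamilies

section SingletonFrame

variable {A : Type*} [CStarAlgebra A] [PartialOrder A] [StarOrderedRing A] {ι : Type*}

theorem isParsevalFrame_const_one [Unique ι] : IsParsevalFrame A fun _ : ι => (1 : A) := by
  intro z
  have hterm : ip A z (1 : A) * ip A (1 : A) z = ip A z z := by
    change star z * 1 * (star 1 * z) = star z * z
    rw [star_one, mul_one, one_mul]
  simp only [hterm]
  exact hasSum_unique fun _ : ι => ip A z z

theorem isOrthonormalFamily_const_one [Subsingleton ι] :
    IsOrthonormalFamily A fun _ : ι => (1 : A) :=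
  ⟨fun _ => (mul_one (star (1 : A))).trans (star_one A),
    fun i j hij => absurd (Subsingleton.elim i j) hij⟩

end SingletonFrame

namespace InternalTensor

variable {A : Type*} [CStarAlgebra A] [PartialOrder A]
  {M X : Type*} [NormedAddCommGroup M] [NormedSpace ℂ M] [Module Aᵐᵒᵖ M]
  [HilbertModule A M] [NormedAddCommGroup X] [NormedSpace ℂ X] [Module Aᵐᵒᵖ X] [Module A X]
  [EssentialCorrespondence A X] {J K : Type*} {m : J → M} {x : K → X}

variable (A) in
/-- The adjoint `n ⊗ y ↦ ⟨m, n⟩ • y` of `x ↦ m ⊗ x`, on the algebraic tensor product. -/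
noncomputable def contract (m : M) : M ⊗[ℂ] X →ₗ[ℂ] X :=
  TensorProduct.lift (LinearMap.mk₂ ℂ (fun (n : M) (y : X) => ip A m n • y)
    (fun n n' y => by rw [ip_add_right, add_smul])
    (fun c n y => by rw [ip_smul_right, PreCorrespondence.smul_assoc_left])
    (fun n y y' => smul_add _ _ _)
    (fun c n y => PreCorrespondence.smul_comm_left _ _ _))

@[simp]
theorem contract_tmul (m n : M) (y : X) : contract A m (n ⊗ₜ y) = ip A m n • y := rfl

variable [StarOrderedRing A]

theorem form_tmul_right (m : M) (x : X) (z : M ⊗[ℂ] X) :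
    form A M X z (m ⊗ₜ x) = ip A (contract A m z) x := by
  induction z using TensorProduct.induction_on with
  | zero => rw [map_zero, map_zero, LinearMap.zero_apply, ip_zero_left]
  | add w w' h h' => rw [map_add, map_add, LinearMap.add_apply, h, h', ip_add_left]
  | tmul n y => rw [form_tmul, contract_tmul]

theorem ip_toCompletion_tmul (z : M ⊗[ℂ] X) (m : M) (x : X) :
    ip A (toCompletion A (E := Alg A M X) z) (tmul A m x) = ip A (contract A m z) x :=
  (ip_toCompletion A (Alg A M X) z (Alg.mk m x)).trans (form_tmul_right m x z)

theorem hasSum_ip_smul_ip_smul (hm : IsParsevalFrame A m) (l n : M) (x y : X) :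
    HasSum (fun j => ip A (ip A (m j) l • x) (ip A (m j) n • y)) (ip A (ip A n l • x) y) := by
  have h := (ipSL A).flip y |>.hasSum ((leftOrbitCLM A x).hasSum (hm.hasSum_ip n l))
  refine h.congr_fun fun j => ?_
  simp only [ContinuousLinearMap.flip_apply, ipSL_apply, leftOrbitCLM_apply]
  rw [mul_smul, PreCorrespondence.ip_smul_left (ip A n (m j)), star_ip]

theorem hasSum_ip_contract (hm : IsParsevalFrame A m) (z w : M ⊗[ℂ] X) :
    HasSum (fun j => ip A (contract A (m j) z) (contract A (m j) w)) (form A M X z w) := by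
  induction w using TensorProduct.induction_on with
  | zero => simpa only [map_zero, ip_zero_right] using hasSum_zero
  | add w w' h h' => simpa only [map_add, ip_add_right] using h.add h'
  | tmul n y =>
    induction z using TensorProduct.induction_on with
    | zero => simpa only [map_zero, ip_zero_left, LinearMap.zero_apply] using hasSum_zero
    | add w w' h h' => simpa only [map_add, ip_add_left, LinearMap.add_apply] using h.add h'
    | tmul l x => simpa only [contract_tmul, form_tmul] using hasSum_ip_smul_ip_smul hm l n x y

theorem isParsevalFrame_tmul (hm : IsParsevalFrame A m) (hx : IsParsevalFrame A x) :
    IsParsevalFrame A fun p : J × K => tmul A (m p.1) (x p.2) := by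
  refine IsParsevalFrame.of_dense (denseRange_toCompletion A (Alg A M X)) ?_
  rintro _ ⟨(z : M ⊗[ℂ] X), rfl⟩
  have hself : ip A (toCompletion A (E := Alg A M X) z) (toCompletion A (E := Alg A M X) z) =
      form A M X z z := ip_toCompletion A (Alg A M X) z z
  rw [hself]
  refine hasSum_prod_of_nonneg (fun p => ip_mul_ip_nonneg A _ _) (fun j => ?_)
    (hasSum_ip_contract hm z z)
  refine (hx (contract A (m j) z)).congr_fun fun k => ?_
  dsimp only
  rw [← star_ip _ (tmul A (m j) (x k)), ← star_ip _ (x k), ip_toCompletion_tmul]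

theorem isOrthonormalFamily_tmul (hm : IsOrthonormalFamily A m)
    (hx : IsOrthonormalFamily A x) :
    IsOrthonormalFamily A fun p : J × K => tmul A (m p.1) (x p.2) := by
  refine ⟨fun p => ?_, fun p q hpq => ?_⟩ <;> rw [ip_tmul_tmul]
  · rw [hm.1, one_smul, hx.1]
  · rcases eq_or_ne p.1 q.1 with h | h
    · rw [h, hm.1, one_smul, hx.2 _ _ fun h' => hpq (Prod.ext h h')]
    · rw [hm.2 _ _ h.symm, zero_smul, ip_zero_left]

end InternalTensor

section TensorWords

variable {A : Type u} [CStarAlgebra A] [PartialOrder A] [StarOrderedRing A]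
  {M : Type u} [NormedAddCommGroup M] [NormedSpace ℂ M] [Module Aᵐᵒᵖ M] [Module A M]
  [EssentialCorrespondence A M] {J : Type w} {m : J → M}

theorem tensorWord_succ_eq_comp (k : ℕ) :
    tensorWord A m (k + 1) =
      (fun p : J × (Fin k → J) => tensorCons A (m p.1) (tensorWord A m k p.2)) ∘
        (Fin.consEquiv fun _ : Fin (k + 1) => J).symm := rfl

theorem isParsevalFrame_tensorWord (hm : IsParsevalFrame A m) (k : ℕ) :
    IsParsevalFrame A (tensorWord A m k) := by
  induction k with
  | zero => exact isParsevalFrame_const_one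
  | succ k ih =>
    rw [tensorWord_succ_eq_comp]
    exact (InternalTensor.isParsevalFrame_tmul hm ih).comp_equiv _

theorem isOrthonormalFamily_tensorWord (hm : IsOrthonormalFamily A m) (k : ℕ) :
    IsOrthonormalFamily A (tensorWord A m k) := by
  induction k with
  | zero => exact isOrthonormalFamily_const_one
  | succ k ih =>
    rw [tensorWord_succ_eq_comp]
    exact (InternalTensor.isOrthonormalFamily_tmul hm ih).comp_injective (Equiv.injective _)

end TensorWords

theorem IsParsevalFrame.hasSum_ip_map {A : Type*} [CStarAlgebra A] [PartialOrder A]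
    {E F : Type*} [NormedAddCommGroup E] [NormedSpace ℂ E] [Module Aᵐᵒᵖ E] [HilbertModule A E]
    [NormedAddCommGroup F] [NormedSpace ℂ F] [Module Aᵐᵒᵖ F] [HilbertModule A F]
    {J K : Type*} {x : J → E} {y : K → F} (hx : IsParsevalFrame A x) (V : IsometricMap A E F)
    {r : J → K} (hr : Function.Injective r) (hV : ∀ j, V (x j) = y (r j))
    (horth : ∀ z, ∀ p ∉ Set.range r, ip A (V z) (y p) = 0) (z : E) :
    HasSum (fun p => ip A (V z) (y p) * ip A (y p) (V z)) (ip A (V z) (V z)) := by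
  refine (hr.hasSum_iff fun p hp => by rw [horth z p hp, zero_mul]).mp ?_
  simpa only [Function.comp_def, ← hV, IsometricMap.ip_map] using hx z

namespace HilbertLimit

variable {A : Type*} [CStarAlgebra A] [PartialOrder A] [StarOrderedRing A]
  {X : ℕ → Type*} [∀ k, NormedAddCommGroup (X k)] [∀ k, NormedSpace ℂ (X k)]
  [∀ k, Module Aᵐᵒᵖ (X k)] [∀ k, HilbertModule A (X k)]
  (T : ∀ k, IsometricMap A (X k) (X (k + 1)))

theorem monotone_range_ι : Monotone fun k => Set.range (ι T k) :=
  monotone_nat_of_le_succ fun k => by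
    rintro _ ⟨x, rfl⟩
    exact ⟨T k x, ι_map T k x⟩

theorem dense_iUnion_range_ι : Dense (⋃ k, Set.range (ι T k)) := by
  refine (denseRange_toCompletion A (Alg T)).mono ?_
  rintro _ ⟨z, rfl⟩
  obtain ⟨k, x, rfl⟩ := Alg.exists_mk T z
  exact Set.mem_iUnion.mpr ⟨k, x, rfl⟩

end HilbertLimit

/-- The index set of `limitFamily`: the empty word `none` and the words in `J` whose first letter
is not `j₀`. -/
abbrev ReducedWord {J : Type*} (j₀ : J) : Type _ :=
  Option (Σ k : ℕ, {j : Fin (k + 1) → J // j 0 ≠ j₀})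

namespace ReducedWord

variable {J : Type*} {j₀ : J}

/-- The number of letters of a reduced word. -/
def length : ReducedWord j₀ → ℕ
  | none => 0
  | some p => p.1 + 1

variable (j₀) in
open Classical in
/-- The reduced word obtained from a word by deleting all leading letters `j₀`. -/
noncomputable def reduce : (k : ℕ) → (Fin k → J) → ReducedWord j₀
  | 0, _ => none
  | k + 1, j => if h : j 0 = j₀ then reduce k (Fin.tail j) else some ⟨k, j, h⟩

theorem reduce_cons_self (k : ℕ) (j : Fin k → J) :
    reduce j₀ (k + 1) (Fin.cons j₀ j) = reduce j₀ k j := by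
  rw [reduce, dif_pos (Fin.cons_zero _ _), Fin.tail_cons]

theorem length_reduce_le (k : ℕ) (j : Fin k → J) : (reduce j₀ k j).length ≤ k := by
  induction k with
  | zero => exact le_rfl
  | succ k ih =>
    rw [reduce]
    split_ifs
    · exact (ih _).trans k.le_succ
    · exact le_rfl

theorem reduce_injective (k : ℕ) : Function.Injective (reduce j₀ k) := by
  induction k with
  | zero => exact Function.injective_of_subsingleton _
  | succ k ih =>
    have hne : ∀ (i : Fin k → J) (j : Fin (k + 1) → J) (hj : j 0 ≠ j₀),
        reduce j₀ k i ≠ some ⟨k, j, hj⟩ := fun i j hj h =>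
      Nat.not_succ_le_self k ((congrArg length h).ge.trans (length_reduce_le k i))
    intro i j h
    rw [reduce, reduce] at h
    split_ifs at h with hi hj hj
    · rw [← Fin.cons_self_tail i, ← Fin.cons_self_tail j, hi, hj, ih h]
    · exact absurd h (hne _ _ _)
    · exact absurd h.symm (hne _ _ _)
    · simpa using h

theorem mem_range_reduce {p : ReducedWord j₀} {k : ℕ} (hp : p.length ≤ k) :
    p ∈ Set.range (reduce j₀ k) := by
  induction k, hp using Nat.le_induction with
  | base =>
    match p with
    | none => exact ⟨Fin.elim0, rfl⟩
    | some ⟨_, j, hj⟩ => exact ⟨j, dif_neg hj⟩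
  | succ k _ ih =>
    obtain ⟨j, rfl⟩ := ih
    exact ⟨Fin.cons j₀ j, reduce_cons_self k j⟩

end ReducedWord

section LimitFamily

variable {A : Type u} [CStarAlgebra A] [PartialOrder A] [StarOrderedRing A]
  {M : Type u} [NormedAddCommGroup M] [NormedSpace ℂ M] [Module Aᵐᵒᵖ M] [Module A M]
  [EssentialCorrespondence A M] {J : Type w} {m : J → M} {j₀ : J}
  (h₀ : ip A (m j₀) (m j₀) = 1)

open ReducedWord

theorem ι_tensorWord (k : ℕ) (j : Fin k → J) :
    HilbertLimit.ι (tensorMap A (m j₀) h₀) k (tensorWord A m k j) =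
      limitFamily A m j₀ h₀ (reduce j₀ k j) := by
  induction k with
  | zero => rfl
  | succ k ih =>
    rw [reduce]
    split_ifs with h
    · rw [← ih, ← HilbertLimit.ι_map _ k, tensorWord, h]
      rfl
    · rfl

theorem ip_ι_limitFamily_eq_zero (hm : IsBessel A m) {k : ℕ} (z : TensorPow A M k)
    {p : ReducedWord j₀} (hp : k < p.length) :
    ip A (HilbertLimit.ι (tensorMap A (m j₀) h₀) k z) (limitFamily A m j₀ h₀ p) = 0 := by
  match p with
  | some ⟨l, j, hj⟩ =>
    have hkl : k ≤ l := Nat.le_of_lt_succ hp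
    obtain ⟨w, hw⟩ := HilbertLimit.monotone_range_ι (tensorMap A (m j₀) h₀) hkl ⟨z, rfl⟩
    rw [← hw, ← HilbertLimit.ι_map]
    calc ip A _ _ = ip A (tensorCons A (m j₀) w) (tensorWord A m (l + 1) j) :=
          IsometricMap.ip_map _ _ _
      _ = ip A (ip A (m (j 0)) (m j₀) • w) _ := ip_tensorCons A _ _ _ _
      _ = 0 := by rw [hm.ip_eq_zero_of_ip_self_eq_one h₀ hj.symm, zero_smul, ip_zero_left]

theorem isParsevalFrame_limitFamily (hm : IsParsevalFrame A m) :
    IsParsevalFrame A (limitFamily A m j₀ h₀) := by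
  refine IsParsevalFrame.of_dense (HilbertLimit.dense_iUnion_range_ι _) fun z hz => ?_
  obtain ⟨k, z, rfl⟩ := Set.mem_iUnion.mp hz
  refine (isParsevalFrame_tensorWord hm k).hasSum_ip_map (HilbertLimit.ι _ k) (reduce_injective k)
    (ι_tensorWord h₀ k) (fun z p hp => ?_) z
  exact ip_ι_limitFamily_eq_zero h₀ hm.isBessel z (not_le.mp (mt mem_range_reduce hp))

theorem isOrthonormalFamily_limitFamily (hm : IsOrthonormalFamily A m) :
    IsOrthonormalFamily A (limitFamily A m j₀ h₀) := by
  have hword := isOrthonormalFamily_tensorWord hm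
  refine ⟨fun (p : ReducedWord j₀) => ?_, fun (p q : ReducedWord j₀) hpq => ?_⟩
  · obtain ⟨j, hj⟩ := mem_range_reduce (le_refl p.length)
    rw [← hj, ← ι_tensorWord, IsometricMap.ip_map, (hword _).1]
  · obtain ⟨k, hp, hq⟩ := exists_ge_ge p.length q.length
    obtain ⟨i, rfl⟩ := mem_range_reduce hp
    obtain ⟨j, rfl⟩ := mem_range_reduce hq
    rw [← ι_tensorWord, ← ι_tensorWord, IsometricMap.ip_map,
      (hword _).2 i j fun hij => hpq (congrArg _ hij)]

end LimitFamily

theorem mainTheorem6_general {A : Type u} [CStarAlgebra A] [PartialOrder A] [StarOrderedRing A]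
    {M : Type u} [NormedAddCommGroup M] [NormedSpace ℂ M] [Module Aᵐᵒᵖ M] [Module A M]
    [EssentialCorrespondence A M]
    {J : Type w} (m : J → M) (hm : IsParsevalFrame A m)
    (j₀ : J) (h₀ : PreHilbertModule.ip A (m j₀) (m j₀) = 1) :
    IsParsevalFrame A (limitFamily A m j₀ h₀) ∧
      (IsOrthonormalBasis A m → IsOrthonormalBasis A (limitFamily A m j₀ h₀)) := by
  have hframe := isParsevalFrame_limitFamily h₀ hm
  refine ⟨hframe, fun hbasis => ?_⟩
  exact hframe.isOrthonormalBasis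
    (isOrthonormalFamily_limitFamily h₀ hbasis.isOrthonormalFamily)

theorem mainTheorem6 {A : Type u} [CStarAlgebra A] [PartialOrder A] [StarOrderedRing A]
    {M : Type u} [NormedAddCommGroup M] [NormedSpace ℂ M] [Module Aᵐᵒᵖ M] [Module A M]
    [EssentialCorrespondence A M]
    {J : Type w} [Countable J] (m : J → M) (hm : IsParsevalFrame A m)
    (j₀ : J) (h₀ : PreHilbertModule.ip A (m j₀) (m j₀) = 1) :
    IsParsevalFrame A (limitFamily A m j₀ h₀) ∧
      (IsOrthonormalBasis A m → IsOrthonormalBasis A (limitFamily A m j₀ h₀)) :=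
  mainTheorem6_general m hm j₀ h₀
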